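/- Let $\mathbb K=\mathbb R$ or $\mathbb C$, let $k,p\ge 1$, $n=kp$, and let $G=G_{n,p}(\mathbb K)=M_{n,p}(\mathbb K)\rtimes GL(\mathbb K^n)$ be the Lie group of pairs $(X,T)$ with product $(X,T)(Y,S)=(X+TY,TS)$. Its Lie algebra is $\mathcal G=M_{n,p}(\mathbb K)\times gl(\mathbb K^n)$ with bracket $[(x,u),(y,v)]=(uy-vx,[u,v])$. For a linear form $\alpha$ on $\mathcal G$ let $\alpha^+$ be the left-invariant $1$-form on $G$ defined by $\alpha$. Divide matrices into $p\times p$ blocks. Let $H_0$ be the $p\times n$ matrix whose blocks are zero except the last one, which is $I_p$, let $N_0$ be the $n\times n$ matrix whose blocks are zero except those just below the diagonal, which are $I_p$, and let $\alpha_0(x,u)=\operatorname{tr}(xH_0)+\operatorname{tr}(N_0u)$. Let $L\subset\mathcal G$ be the set of $(x,u)$ with $x$ arbitrary and $u$ strictly upper triangular by blocks, and let $L'\subset\mathcal G$ be the set of $(0,u)$ with $u$ lower triangular by blocks (arbitrary diagonal blocks). Let $\Lambda$ and $\Lambda'$ be the subgroups of $G$ generated by the exponentials of the elements of $L$ and of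 $L'$, respectively. If $\omega=d\alpha^+$ is symplectic, let $\nabla^+$ be the left-invariant connection on $G$ with $\omega(\nabla^+_{x^+}y^+,z^+)=-\omega(y^+,[x^+,z^+])$ for all $x,y,z\in\mathcal G$, where $x^+$ is the left-invariant vector field of $x$. **Theorem 3.2.** The form $d\alpha_0^+$ is a left-invariant symplectic form on $G$, and $\Lambda$ and $\Lambda'$ have Lie algebras $L$ and $L'$. Let $\alpha$ be any linear form on $\mathcal G$ such that $\omega=d\alpha^+$ is symplectic. Then $\nabla^+$ is torsion free and flat, and there are an element $c\in G$, with $c=1$ if $\alpha=\alpha_0$, and two left-invariant foliations $\mathcal F,\mathcal F'$ of $G$ such that: 1. $\mathcal F$ and $\mathcal F'$ are Lagrangian for $\omega$, and at every point of $G$ their tangent spaces are supplementary; 2. for every $g\in G$ the leaf of $\mathcal F$ through $g$ is $g\,c\Lambda c^{-1}$, and the leaf of $\mathcal F'$ through $g$ is $g\,c\Lambda'c^{-1}$; 3. all leaves of $\mathcal F$ and $\mathcal F'$ are closed in $G$ and are affine submanifolds for $\nabla^+$, that is, if $X$ and $Y$ are vector fields tangent to a leaf along it, then so is $\nabla^+_XY$.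 -/

import Mathlib

open scoped ContDiff Manifold Matrix Topology

namespace Gnp

noncomputable section

/-- The vector space `M_{n,p}(𝕜) × M_{n,n}(𝕜)` with `n = k p`. The index set of `𝕜ⁿ` is written as
`Fin k × Fin p`, so that the index `(a, i)` is the `i`-th index of the `a`-th block. This vector
space is the Lie algebra of `G_{n,p}(𝕜)`; it is also the space in which `G_{n,p}(𝕜)` is open.
Matrices are written here as functions of two indices, for which Mathlib has a norm. -/
abbrev E (𝕜 : Type*) (k p : ℕ) : Type _ :=
  (Fin k × Fin p → Fin p → 𝕜) × (Fin k × Fin p → Fin k × Fin p → 𝕜)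

/-- The element `(x, u)` of `E` given by two matrices. -/
def pair {𝕜 : Type*} {k p : ℕ} (x : Matrix (Fin k × Fin p) (Fin p) 𝕜)
    (u : Matrix (Fin k × Fin p) (Fin k × Fin p) 𝕜) : E 𝕜 k p :=
  (fun i j => x i j, fun i j => u i j)

/-- The first matrix of an element of `E`. -/
def fstM {𝕜 : Type*} {k p : ℕ} (e : E 𝕜 k p) : Matrix (Fin k × Fin p) (Fin p) 𝕜 :=
  Matrix.of e.1

/-- The second matrix of an element of `E`. -/
def sndM {𝕜 : Type*} {k p : ℕ} (e : E 𝕜 k p) : Matrix (Fin k × Fin p) (Fin k × Fin p) 𝕜 :=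
  Matrix.of e.2

/-- The group `G_{n,p}(𝕜) = M_{n,p}(𝕜) ⋊ GL(𝕜ⁿ)`, `n = k p`: pairs `(X, T)`. -/
@[ext]
structure G (𝕜 : Type*) [RCLike 𝕜] (k p : ℕ) where
  /-- The component in the additive group of matrices. -/
  X : Matrix (Fin k × Fin p) (Fin p) 𝕜
  /-- The component in the general linear group. -/
  T : Matrix.GeneralLinearGroup (Fin k × Fin p) 𝕜

variable {𝕜 : Type*} [RCLike 𝕜] {k p : ℕ}

section

variable (x : Matrix (Fin k × Fin p) (Fin p) 𝕜) (u : Matrix (Fin k × Fin p) (Fin k × Fin p) 𝕜)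
  (a b : E 𝕜 k p) (c : 𝕜)

@[simp] lemma fstM_pair : fstM (pair x u) = x := rfl
@[simp] lemma sndM_pair : sndM (pair x u) = u := rfl
@[simp] lemma pair_fstM_sndM : pair (fstM a) (sndM a) = a := rfl
@[simp] lemma fstM_zero : fstM (0 : E 𝕜 k p) = 0 := rfl
@[simp] lemma sndM_zero : sndM (0 : E 𝕜 k p) = 0 := rfl
@[simp] lemma fstM_add : fstM (a + b) = fstM a + fstM b := rfl
@[simp] lemma sndM_add : sndM (a + b) = sndM a + sndM b := rfl
@[simp] lemma fstM_smul : fstM (c • a) = c • fstM a := rfl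
@[simp] lemma sndM_smul : sndM (c • a) = c • sndM a := rfl

end

namespace G

instance : Mul (G 𝕜 k p) := ⟨fun g h => ⟨g.X + g.T.val * h.X, g.T * h.T⟩⟩
instance : One (G 𝕜 k p) := ⟨⟨0, 1⟩⟩
instance : Inv (G 𝕜 k p) := ⟨fun g => ⟨-(g.T⁻¹.val * g.X), g.T⁻¹⟩⟩

@[simp] lemma mul_X (g h : G 𝕜 k p) : (g * h).X = g.X + g.T.val * h.X := rfl
@[simp] lemma mul_T (g h : G 𝕜 k p) : (g * h).T = g.T * h.T := rfl
@[simp] lemma one_X : (1 : G 𝕜 k p).X = 0 := rfl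
@[simp] lemma one_T : (1 : G 𝕜 k p).T = 1 := rfl
@[simp] lemma inv_X (g : G 𝕜 k p) : (g⁻¹).X = -(g.T⁻¹.val * g.X) := rfl
@[simp] lemma inv_T (g : G 𝕜 k p) : (g⁻¹).T = g.T⁻¹ := rfl

/-- The semidirect product, with `GL(𝕜ⁿ)` acting on `M_{n,p}(𝕜)` by multiplication. -/
instance : Group (G 𝕜 k p) := Group.ofLeftAxioms
  (fun a b c => by
    ext1
    · simp [Matrix.mul_add, Matrix.mul_assoc, add_assoc]
    · simp [mul_assoc])
  (fun a => by ext1 <;> simp)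
  (fun a => by ext1 <;> simp)

/-- The inclusion of `G_{n,p}(𝕜)` in the vector space `E`. It is the global chart of the manifold
`G_{n,p}(𝕜)`; all tangent spaces are identified with `E` through it. -/
def toE (g : G 𝕜 k p) : E 𝕜 k p := pair g.X g.T.val

instance : TopologicalSpace (G 𝕜 k p) := TopologicalSpace.induced toE inferInstance

lemma toE_injective : Function.Injective (toE : G 𝕜 k p → E 𝕜 k p) := fun g h hgh => by
  have h1 := congrArg Prod.fst hgh
  have h2 := congrArg Prod.snd hgh
  ext1
  · exact h1
  · exact Units.ext h2

lemma range_toE : Set.range (toE : G 𝕜 k p → E 𝕜 k p) = {e | (sndM e).det ≠ 0} := by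
  ext e
  constructor
  · rintro ⟨g, rfl⟩
    exact ((Matrix.isUnit_iff_isUnit_det _).1 g.T.isUnit).ne_zero
  · intro he
    exact ⟨⟨fstM e, Matrix.GeneralLinearGroup.mkOfDetNeZero (sndM e) he⟩, rfl⟩

lemma contDiff_det_sndM : ContDiff 𝕜 ∞ (fun e : E 𝕜 k p => (sndM e).det) := by
  simp only [Matrix.det_apply, sndM, Matrix.of_apply]
  refine ContDiff.sum fun s _ => ContDiff.const_smul _ (contDiff_prod fun i _ => ?_)
  fun_prop

instance : Nonempty (G 𝕜 k p) := ⟨1⟩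

lemma isOpenEmbedding_toE : Topology.IsOpenEmbedding (toE : G 𝕜 k p → E 𝕜 k p) where
  eq_induced := rfl
  injective := toE_injective
  isOpen_range := by
    rw [range_toE]
    exact isOpen_ne_fun contDiff_det_sndM.continuous continuous_const

instance : ChartedSpace (E 𝕜 k p) (G 𝕜 k p) := isOpenEmbedding_toE.singletonChartedSpace

instance : IsManifold 𝓘(𝕜, E 𝕜 k p) ∞ (G 𝕜 k p) := isOpenEmbedding_toE.isManifold_singleton

lemma contMDiff_toE : ContMDiff 𝓘(𝕜, E 𝕜 k p) 𝓘(𝕜, E 𝕜 k p) ∞ (toE : G 𝕜 k p → E 𝕜 k p) :=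
  contMDiff_isOpenEmbedding isOpenEmbedding_toE

lemma contDiffAt_inv_sndM (e : E 𝕜 k p) (he : (sndM e).det ≠ 0) (i j : Fin k × Fin p) :
    ContDiffAt 𝕜 ∞ (fun e : E 𝕜 k p => (sndM e)⁻¹ i j) e := by
  simp only [Matrix.inv_def, Ring.inverse_eq_inv', Matrix.smul_apply, smul_eq_mul]
  refine ContDiffAt.mul (contDiff_det_sndM.contDiffAt.inv he) (ContDiff.contDiffAt ?_)
  simp only [Matrix.adjugate_apply, Matrix.det_apply]
  refine ContDiff.sum fun s _ => ContDiff.const_smul _ (contDiff_prod fun a _ => ?_)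
  by_cases h : s a = j
  · simpa [Matrix.updateRow_apply, h] using contDiff_const
  · simp only [Matrix.updateRow_apply, h, if_false, sndM, Matrix.of_apply]
    fun_prop

/-- `G_{n,p}(𝕜)` is a Lie group over `𝕜`. -/
instance : LieGroup 𝓘(𝕜, E 𝕜 k p) ∞ (G 𝕜 k p) where
  contMDiff_mul := by
    apply ContMDiff.of_comp_isOpenEmbedding isOpenEmbedding_toE
    have h : ContMDiff (𝓘(𝕜, E 𝕜 k p).prod 𝓘(𝕜, E 𝕜 k p)) 𝓘(𝕜, E 𝕜 k p × E 𝕜 k p) ∞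
        (fun q : G 𝕜 k p × G 𝕜 k p => (q.1.toE, q.2.toE)) :=
      (contMDiff_toE.comp contMDiff_fst).prodMk_space (contMDiff_toE.comp contMDiff_snd)
    have h2 : ContDiff 𝕜 ∞ (fun q : E 𝕜 k p × E 𝕜 k p =>
        pair (fstM q.1 + sndM q.1 * fstM q.2) (sndM q.1 * sndM q.2)) := by
      simp only [pair, fstM, sndM, Matrix.add_apply, Matrix.mul_apply, Matrix.of_apply]
      fun_prop
    exact h2.contMDiff.comp h
  contMDiff_inv := by
    apply ContMDiff.of_comp_isOpenEmbedding isOpenEmbedding_toE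
    intro g
    have hg : (sndM g.toE).det ≠ 0 := by
      have : g.toE ∈ Set.range (toE : G 𝕜 k p → E 𝕜 k p) := ⟨g, rfl⟩
      rwa [range_toE] at this
    have h1 := contDiffAt_inv_sndM g.toE hg
    have h2 : ContDiffAt 𝕜 ∞
        (fun e : E 𝕜 k p => pair (-((sndM e)⁻¹ * fstM e)) (sndM e)⁻¹) g.toE := by
      refine ContDiffAt.prodMk (contDiffAt_pi.2 fun i => contDiffAt_pi.2 fun j => ?_)
        (contDiffAt_pi.2 fun i => contDiffAt_pi.2 fun j => h1 i j)
      simp only [fstM, Matrix.neg_apply, Matrix.mul_apply, Matrix.of_apply]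
      refine ContDiffAt.neg (ContDiffAt.sum fun a _ => ContDiffAt.mul (h1 i a) ?_)
      fun_prop
    have h3 : (toE : G 𝕜 k p → E 𝕜 k p) ∘ (fun g => g⁻¹) =
        (fun e : E 𝕜 k p => pair (-((sndM e)⁻¹ * fstM e)) (sndM e)⁻¹) ∘ toE := by
      funext h
      simp [toE, Matrix.coe_units_inv]
    rw [h3]
    exact ContMDiffAt.comp g h2.contMDiffAt (contMDiff_toE g)

end G

/-- The differential of the left translation by `(X, T)`: the left translation is
`(Y, S) ↦ (X + T Y, T S)`, so that its differential at every point is `v ↦ (T v₁, T v₂)`. -/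
def dL (T : Matrix (Fin k × Fin p) (Fin k × Fin p) 𝕜) : E 𝕜 k p →ₗ[𝕜] E 𝕜 k p where
  toFun v := pair (T * fstM v) (T * sndM v)
  map_add' v w := by
    ext <;> simp [pair, fstM, sndM, Matrix.mul_apply, mul_add, Finset.sum_add_distrib]
  map_smul' c v := by
    ext <;> simp [pair, fstM, sndM, Matrix.mul_apply, Finset.mul_sum, mul_left_comm]

/-- The left invariant vector field `x⁺` of an element `x` of the Lie algebra. -/
def leftField (x : E 𝕜 k p) (e : E 𝕜 k p) : E 𝕜 k p := dL (sndM e) x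

/-- The left invariant `1`-form `α⁺` of a linear form `α` on the Lie algebra. -/
def leftForm (α : E 𝕜 k p →ₗ[𝕜] 𝕜) (e : E 𝕜 k p) : E 𝕜 k p [⋀^Fin 1]→L[𝕜] 𝕜 :=
  ContinuousAlternatingMap.ofSubsingleton 𝕜 (E 𝕜 k p) 𝕜 (0 : Fin 1)
    (LinearMap.toContinuousLinearMap (α ∘ₗ dL (sndM e)⁻¹))

/-- The `2`-form `dα⁺`. -/
def dLeftForm (α : E 𝕜 k p →ₗ[𝕜] 𝕜) : E 𝕜 k p → E 𝕜 k p [⋀^Fin 2]→L[𝕜] 𝕜 :=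
  extDeriv (leftForm α)

/-- `(G_{n,p}(𝕜), Ω)` is a symplectic Lie group: `Ω` is a smooth (holomorphic if `𝕜 = ℂ`), closed,
nondegenerate, left invariant `2`-form on `G_{n,p}(𝕜)`. -/
structure IsLeftInvariantSymplectic (Ω : E 𝕜 k p → E 𝕜 k p [⋀^Fin 2]→L[𝕜] 𝕜) : Prop where
  smooth : ContDiffOn 𝕜 ∞ Ω (Set.range (G.toE : G 𝕜 k p → E 𝕜 k p))
  closed : ∀ g : G 𝕜 k p, extDeriv Ω g.toE = 0
  nondegenerate : ∀ (g : G 𝕜 k p) (v : E 𝕜 k p), (∀ w, Ω g.toE ![v, w] = 0) → v = 0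
  leftInvariant : ∀ (g h : G 𝕜 k p) (v w : E 𝕜 k p),
    Ω (g * h).toE ![dL g.T.val v, dL g.T.val w] = Ω h.toE ![v, w]

/-- The linear form `α_{(H,N)} : (x, u) ↦ tr (x H) + tr (N u)` on the Lie algebra. -/
def linForm (H : Matrix (Fin p) (Fin k × Fin p) 𝕜)
    (N : Matrix (Fin k × Fin p) (Fin k × Fin p) 𝕜) : E 𝕜 k p →ₗ[𝕜] 𝕜 where
  toFun a := (fstM a * H).trace + (N * sndM a).trace
  map_add' a b := by simp [Matrix.add_mul, Matrix.mul_add]; ring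
  map_smul' c a := by simp [mul_add]

/-- `H₀`: all `p × p` blocks are zero, except the last one, which is the identity. -/
def H₀ (𝕜 : Type*) [RCLike 𝕜] (k p : ℕ) : Matrix (Fin p) (Fin k × Fin p) 𝕜 :=
  Matrix.of fun i b => if b.1.val + 1 = k ∧ i = b.2 then 1 else 0

/-- `N₀`: all `p × p` blocks are zero, except those just below the diagonal, which are the
identity. -/
def N₀ (𝕜 : Type*) [RCLike 𝕜] (k p : ℕ) : Matrix (Fin k × Fin p) (Fin k × Fin p) 𝕜 :=
  Matrix.of fun a b => if a.1.val = b.1.val + 1 ∧ a.2 = b.2 then 1 else 0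

/-- The linear form `α₀ = (H₀, N₀)`. -/
def α₀ (𝕜 : Type*) [RCLike 𝕜] (k p : ℕ) : E 𝕜 k p →ₗ[𝕜] 𝕜 := linForm (H₀ 𝕜 k p) (N₀ 𝕜 k p)

/-- The product of the Lie algebra given by a left invariant symplectic form `Ω`: `x y` is the
unique vector such that `Ω (x y, z) = - Ω (y, [x, z])` for all `z`, at the identity. The bracket is
the Lie bracket of the left invariant vector fields. -/
def symProd (Ω : E 𝕜 k p → E 𝕜 k p [⋀^Fin 2]→L[𝕜] 𝕜) (x y : E 𝕜 k p) : E 𝕜 k p :=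
  Classical.epsilon fun w => ∀ z : E 𝕜 k p,
    Ω (1 : G 𝕜 k p).toE ![w, z] = - Ω (1 : G 𝕜 k p).toE
      ![y, VectorField.lieBracket 𝕜 (leftField x) (leftField z) (1 : G 𝕜 k p).toE]

/-- The left invariant connection `∇⁺` of a left invariant symplectic form `Ω`, that is, the one
with `Ω (∇⁺_{x⁺} y⁺, z⁺) = - Ω (y⁺, [x⁺, z⁺])`, so that `∇⁺_{x⁺} y⁺ = (x y)⁺`. A vector field `Y` is
written in the left trivialization as the function `e ↦ e⁻¹ Y(e)` with values in the Lie algebra,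
and the Leibniz rule gives the value of `∇⁺_X Y` at `e`. -/
def conn (Ω : E 𝕜 k p → E 𝕜 k p [⋀^Fin 2]→L[𝕜] 𝕜) (X Y : E 𝕜 k p → E 𝕜 k p) (e : E 𝕜 k p) :
    E 𝕜 k p :=
  dL (sndM e) (fderiv 𝕜 (fun e' : E 𝕜 k p => dL (sndM e')⁻¹ (Y e')) e (X e)
    + symProd Ω (dL (sndM e)⁻¹ (X e)) (dL (sndM e)⁻¹ (Y e)))

/-- `∇⁺` has no torsion and no curvature, so that it is an affine structure on `G_{n,p}(𝕜)`. As
torsion and curvature are tensors, they are evaluated on left invariant fields. -/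
structure IsAffineStructure (Ω : E 𝕜 k p → E 𝕜 k p [⋀^Fin 2]→L[𝕜] 𝕜) : Prop where
  torsion_free : ∀ (x y : E 𝕜 k p) (g : G 𝕜 k p),
    conn Ω (leftField x) (leftField y) g.toE - conn Ω (leftField y) (leftField x) g.toE
      = VectorField.lieBracket 𝕜 (leftField x) (leftField y) g.toE
  flat : ∀ (x y z : E 𝕜 k p) (g : G 𝕜 k p),
    conn Ω (leftField x) (conn Ω (leftField y) (leftField z)) g.toE
      - conn Ω (leftField y) (conn Ω (leftField x) (leftField z)) g.toE
      = conn Ω (VectorField.lieBracket 𝕜 (leftField x) (leftField y)) (leftField z) g.toE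

/-- A (smooth, or holomorphic if `𝕜 = ℂ`) foliation of `G_{n,p}(𝕜)`, given by its tangent
distribution. Around every point there is a flat chart `φ`: the tangent spaces of the foliation are
those of the slices `φ₂ = const`. -/
structure Foliation (𝕜 : Type*) [RCLike 𝕜] (k p : ℕ) where
  /-- The tangent space of the foliation at a point. -/
  tangent : G 𝕜 k p → Submodule 𝕜 (E 𝕜 k p)
  exists_flat_chart : ∀ g : G 𝕜 k p, ∃ (d c : ℕ)
    (φ : OpenPartialHomeomorph (E 𝕜 k p) ((Fin d → 𝕜) × (Fin c → 𝕜))),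
    g.toE ∈ φ.source ∧ φ.source ⊆ Set.range (G.toE : G 𝕜 k p → E 𝕜 k p) ∧
    ContDiffOn 𝕜 ∞ φ φ.source ∧ ContDiffOn 𝕜 ∞ φ.symm φ.target ∧
    ∀ h : G 𝕜 k p, h.toE ∈ φ.source →
      ∀ v : E 𝕜 k p, v ∈ tangent h ↔ (fderiv 𝕜 φ h.toE v).2 = 0

namespace Foliation

/-- `g` and `h` are the end points of a `C¹` path tangent to the foliation. -/
def Joined (F : Foliation 𝕜 k p) (g h : G 𝕜 k p) : Prop :=
  ∃ γ : ℝ → G 𝕜 k p, γ 0 = g ∧ γ 1 = h ∧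
    ContDiffOn ℝ 1 (fun t => (γ t).toE) (Set.Icc 0 1) ∧
    ∀ t ∈ Set.Icc (0 : ℝ) 1,
      derivWithin (fun t => (γ t).toE) (Set.Icc 0 1) t ∈ F.tangent (γ t)

/-- The leaf through `g`: the points that are joined to `g` by a piecewise `C¹` path tangent to the
foliation (the maximal connected integral manifold through `g`). -/
def leaf (F : Foliation 𝕜 k p) (g : G 𝕜 k p) : Set (G 𝕜 k p) :=
  {h | Relation.ReflTransGen F.Joined g h}

/-- The foliation is preserved by the left translations. -/
def IsLeftInvariant (F : Foliation 𝕜 k p) : Prop :=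
  ∀ g h : G 𝕜 k p, F.tangent (g * h) = (F.tangent h).map (dL g.T.val)

/-- Every tangent space of the foliation is equal to its own `Ω`-orthogonal. -/
def IsLagrangian (F : Foliation 𝕜 k p) (Ω : E 𝕜 k p → E 𝕜 k p [⋀^Fin 2]→L[𝕜] 𝕜) : Prop :=
  ∀ (g : G 𝕜 k p) (v : E 𝕜 k p),
    v ∈ F.tangent g ↔ ∀ w ∈ F.tangent g, Ω g.toE ![v, w] = 0

/-- The tangent spaces of the two foliations are supplementary at every point. -/
def Transversal (F F' : Foliation 𝕜 k p) : Prop :=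
  ∀ g : G 𝕜 k p, IsCompl (F.tangent g) (F'.tangent g)

/-- The leaf through `g` is an affine submanifold for `∇⁺`: if `X` and `Y` are smooth vector fields
near a point `h` of the leaf that are tangent to the leaf at its points near `h`, then so is
`∇⁺_X Y` at `h`. -/
def HasAffineLeaf (F : Foliation 𝕜 k p) (Ω : E 𝕜 k p → E 𝕜 k p [⋀^Fin 2]→L[𝕜] 𝕜)
    (g : G 𝕜 k p) : Prop :=
  ∀ h ∈ F.leaf g, ∀ X Y : E 𝕜 k p → E 𝕜 k p,
    ContDiffAt 𝕜 ∞ X h.toE → ContDiffAt 𝕜 ∞ Y h.toE →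
    (∀ᶠ m in 𝓝 h, m ∈ F.leaf g → X m.toE ∈ F.tangent m ∧ Y m.toE ∈ F.tangent m) →
    conn Ω X Y h.toE ∈ F.tangent h

end Foliation

/-- The canonical embedding of the Lie algebra of `G_{n,p}(𝕜)` in `gl(𝕜ⁿ⁺ᵖ)`. -/
def algEmb (a : E 𝕜 k p) :
    Matrix ((Fin k × Fin p) ⊕ Fin p) ((Fin k × Fin p) ⊕ Fin p) 𝕜 :=
  Matrix.fromBlocks (sndM a) (fstM a) 0 0

/-- The canonical embedding of `G_{n,p}(𝕜)` in `GL(𝕜ⁿ⁺ᵖ)`. -/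
def grpEmb (g : G 𝕜 k p) :
    Matrix ((Fin k × Fin p) ⊕ Fin p) ((Fin k × Fin p) ⊕ Fin p) 𝕜 :=
  Matrix.fromBlocks g.T.val g.X 0 1

/-- `g` is the exponential of `a`. -/
def IsExp (a : E 𝕜 k p) (g : G 𝕜 k p) : Prop := grpEmb g = NormedSpace.exp (algEmb a)

/-- The subgroup generated by the exponentials of the elements of `𝔥`. If `𝔥` is a Lie subalgebra,
it is the connected Lie subgroup with Lie algebra `𝔥`. -/
def connSubgroup (𝔥 : Submodule 𝕜 (E 𝕜 k p)) : Subgroup (G 𝕜 k p) :=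
  Subgroup.closure {g | ∃ a ∈ 𝔥, IsExp a g}

/-- The Lie algebra of a subgroup `Λ`, as a set: the generators of the one-parameter subgroups that
are contained in `Λ`. -/
def lieAlgebraOf (Λ : Subgroup (G 𝕜 k p)) : Set (E 𝕜 k p) :=
  {a | ∀ t : ℝ, ∃ g ∈ Λ, IsExp (t • a) g}

/-- `L`: the elements `(x, u)` of the Lie algebra with `u` strictly upper triangular by `p × p`
blocks, that is, those whose image in `gl(𝕜ⁿ⁺ᵖ)` is strictly upper triangular by blocks. -/
def L (𝕜 : Type*) [RCLike 𝕜] (k p : ℕ) : Submodule 𝕜 (E 𝕜 k p) where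
  carrier := {a | ∀ i j : Fin k × Fin p, j.1 ≤ i.1 → sndM a i j = 0}
  add_mem' := fun {a b} ha hb i j hij => by
    have h1 := ha i j hij
    have h2 := hb i j hij
    simp [h1, h2]
  zero_mem' := fun i j _ => by simp
  smul_mem' := fun c a ha i j hij => by
    have h1 := ha i j hij
    simp [h1]

/-- `L'`: the elements `(0, u)` of the Lie algebra with `u` lower triangular by `p × p` blocks
(the diagonal blocks are arbitrary). -/
def L' (𝕜 : Type*) [RCLike 𝕜] (k p : ℕ) : Submodule 𝕜 (E 𝕜 k p) where
  carrier := {a | fstM a = 0 ∧ ∀ i j : Fin k × Fin p, i.1 < j.1 → sndM a i j = 0}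
  add_mem' := fun ha hb =>
    ⟨by simp [ha.1, hb.1], fun i j hij => by simp [ha.2 i j hij, hb.2 i j hij]⟩
  zero_mem' := ⟨by simp, fun i j _ => by simp⟩
  smul_mem' := fun c a ha => ⟨by simp [ha.1], fun i j hij => by simp [ha.2 i j hij]⟩

end

end Gnp

open Gnp

namespace Gnp

noncomputable section

variable {𝕜 : Type*} [RCLike 𝕜] {k p : ℕ}

/-! The proof rests on two facts. The first is that the symplectic forms `dα⁺` form one coadjoint
orbit. Write `α = (H, N)`. The radical of `(x, y) ↦ α [x, y]` consists of the `(x, u)` with `H u =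
0` and `N u - u N = x H` (`linForm_bracketE_eq_zero_iff`). If it is trivial, the rows of `H, H N, …,
H N ^ (k - 1)` have no common zero (`TrivialRadical.eq_zero`); there are `k p = n` of them, so they
form a basis of the dual of `𝕜ⁿ`. The coadjoint action by `(X, T)` changes the basis by `T` and adds
a multiple of `H` to `N`. As in control theory (Brunovsky form of an observable pair), this brings
`(H, N)` to `(H₀, N₀)`, so `α = α₀ ∘ Ad g` (`exists_α₀_Ad_eq`) and `c = g⁻¹`.

The second is that `L` and `L'` are closed under the associative product of `gl(𝕜ⁿ⁺ᵖ)`, not only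
under the bracket. For a subspace `𝔥` of this kind, `(1 + 𝔥) ∩ G` is a closed subgroup, and the
exponentials of `𝔥` fill a neighbourhood of `1` in it. Hence the generated subgroup is closed with
Lie algebra `𝔥` (`isClosed_connSubgroup`, `lieAlgebraOf_connSubgroup`), and its left cosets are the
leaves of the left-invariant foliation tangent to `𝔥` (`leftFoliation_leaf`).

For `α₀`, the complementary subspaces `L` and `L'` are isotropic, hence Lagrangian. The conjugates
`Ad g⁻¹ L` and `Ad g⁻¹ L'` inherit this for `α`, and a Lagrangian subalgebra is stable under the
product that defines `∇⁺` (`symProd_mem`), so the leaves are affine. Torsion-freeness and flatness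
of `∇⁺` are the Jacobi identity. -/

@[simp] lemma fstM_sub (a b : E 𝕜 k p) : fstM (a - b) = fstM a - fstM b := rfl
@[simp] lemma sndM_sub (a b : E 𝕜 k p) : sndM (a - b) = sndM a - sndM b := rfl
@[simp] lemma fstM_dL (T : Matrix (Fin k × Fin p) (Fin k × Fin p) 𝕜) (v : E 𝕜 k p) :
    fstM (dL T v) = T * fstM v := rfl
@[simp] lemma sndM_dL (T : Matrix (Fin k × Fin p) (Fin k × Fin p) 𝕜) (v : E 𝕜 k p) :
    sndM (dL T v) = T * sndM v := rfl
@[simp] lemma fstM_toE (g : G 𝕜 k p) : fstM g.toE = g.X := rfl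
@[simp] lemma sndM_toE (g : G 𝕜 k p) : sndM g.toE = g.T.val := rfl

lemma ext_fstM_sndM {a b : E 𝕜 k p} (h1 : fstM a = fstM b) (h2 : sndM a = sndM b) : a = b :=
  Prod.ext h1 h2

lemma dL_dL (S T : Matrix (Fin k × Fin p) (Fin k × Fin p) 𝕜) (v : E 𝕜 k p) :
    dL S (dL T v) = dL (S * T) v :=
  ext_fstM_sndM (by simp [Matrix.mul_assoc]) (by simp [Matrix.mul_assoc])

@[simp] lemma dL_one (v : E 𝕜 k p) : dL 1 v = v := ext_fstM_sndM (by simp) (by simp)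

lemma dL_add_left (S T : Matrix (Fin k × Fin p) (Fin k × Fin p) 𝕜) (v : E 𝕜 k p) :
    dL (S + T) v = dL S v + dL T v :=
  ext_fstM_sndM (by simp [Matrix.add_mul]) (by simp [Matrix.add_mul])

lemma dL_smul_left (c : 𝕜) (T : Matrix (Fin k × Fin p) (Fin k × Fin p) 𝕜) (v : E 𝕜 k p) :
    dL (c • T) v = c • dL T v :=
  ext_fstM_sndM (by simp) (by simp)

/-! ### The associative product, invariant fields and the form `dα⁺` -/

/-- The associative product `(x, u) (y, v) = (u y, u v)`; it is the product of `gl(𝕜ⁿ⁺ᵖ)`. -/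
def mulE (a b : E 𝕜 k p) : E 𝕜 k p := dL (sndM a) b

lemma mulE_apply (a b : E 𝕜 k p) : mulE a b = dL (sndM a) b := rfl

@[simp] lemma fstM_mulE (a b : E 𝕜 k p) : fstM (mulE a b) = sndM a * fstM b := rfl
@[simp] lemma sndM_mulE (a b : E 𝕜 k p) : sndM (mulE a b) = sndM a * sndM b := rfl

variable (𝕜 k p) in
/-- The product `mulE` as a continuous bilinear map. -/
def mulCLM : E 𝕜 k p →L[𝕜] E 𝕜 k p →L[𝕜] E 𝕜 k p :=
  LinearMap.toContinuousBilinearMap (LinearMap.mk₂ 𝕜 mulE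
    (fun a b v => by simp [mulE, dL_add_left]) (fun c a v => by simp [mulE, dL_smul_left])
    (fun a b v => by simp [mulE]) (fun c a v => by simp [mulE]))

lemma mulCLM_apply (a b : E 𝕜 k p) : mulCLM 𝕜 k p a b = mulE a b := rfl

lemma mulE_add (a b c : E 𝕜 k p) : mulE a (b + c) = mulE a b + mulE a c := by simp [mulE]
lemma mulE_sub (a b c : E 𝕜 k p) : mulE a (b - c) = mulE a b - mulE a c := by simp [mulE]
lemma add_mulE (a b c : E 𝕜 k p) : mulE (a + b) c = mulE a c + mulE b c := by
  simp [← mulCLM_apply]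
lemma sub_mulE (a b c : E 𝕜 k p) : mulE (a - b) c = mulE a c - mulE b c := by
  simp [← mulCLM_apply]
@[simp] lemma mulE_zero (a : E 𝕜 k p) : mulE a 0 = 0 := by simp [mulE]
@[simp] lemma zero_mulE (a : E 𝕜 k p) : mulE 0 a = 0 := by simp [← mulCLM_apply]
lemma mulE_smul (t : 𝕜) (a b : E 𝕜 k p) : mulE a (t • b) = t • mulE a b := by simp [mulE]
lemma smul_mulE (t : 𝕜) (a b : E 𝕜 k p) : mulE (t • a) b = t • mulE a b := by
  simp [← mulCLM_apply]

lemma mulE_assoc (a b c : E 𝕜 k p) : mulE (mulE a b) c = mulE a (mulE b c) := by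
  simp [mulE_apply, dL_dL]

@[simp] lemma mulE_toE_one (a : E 𝕜 k p) : mulE (1 : G 𝕜 k p).toE a = a := by
  simp [mulE_apply]

/-- In `gl(𝕜ⁿ⁺ᵖ)` this is `(1 + a) (1 + b) = (1 + a) + (1 + a) b`. The difference `h - 1` is needed
because `1.toE` is only a left unit for `mulE`. -/
lemma toE_mul (g h : G 𝕜 k p) :
    (g * h).toE = g.toE + mulE g.toE (h.toE - (1 : G 𝕜 k p).toE) :=
  ext_fstM_sndM (by simp) (by simp [Matrix.mul_sub])

/-- The bracket of the Lie algebra of `G_{n,p}(𝕜)`. -/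
def bracketE (x y : E 𝕜 k p) : E 𝕜 k p := mulE x y - mulE y x

lemma bracketE_jacobi (x y z : E 𝕜 k p) :
    bracketE (bracketE x y) z = bracketE x (bracketE y z) - bracketE y (bracketE x z) := by
  simp only [bracketE, mulE_sub, sub_mulE, mulE_assoc]
  abel

/-- In the chart `E` the field `x⁺` is the linear map `e ↦ e x`, so the Lie bracket is a commutator
of right multiplications. -/
lemma lieBracket_leftField (x y : E 𝕜 k p) :
    VectorField.lieBracket 𝕜 (leftField x) (leftField y) = leftField (bracketE x y) := by
  have h : ∀ x : E 𝕜 k p, leftField x = (mulCLM 𝕜 k p).flip x := fun x => rfl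
  funext e
  rw [VectorField.lieBracket_eq]
  simp only [h, ContinuousLinearMap.fderiv, ContinuousLinearMap.flip_apply, bracketE, mulCLM_apply,
    mulE_sub, mulE_assoc]

lemma det_sndM_toE_ne_zero (g : G 𝕜 k p) : (sndM g.toE).det ≠ 0 :=
  ((Matrix.isUnit_iff_isUnit_det _).1 g.T.isUnit).ne_zero

lemma eventually_det_ne_zero (g : G 𝕜 k p) : ∀ᶠ e in 𝓝 g.toE, (sndM e).det ≠ 0 :=
  (G.contDiff_det_sndM.continuous.continuousAt).eventually_ne (det_sndM_toE_ne_zero g)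

lemma exists_toE_eq {e : E 𝕜 k p} (he : (sndM e).det ≠ 0) : ∃ g : G 𝕜 k p, g.toE = e := by
  rw [← Set.mem_range, G.range_toE]
  exact he

lemma dL_inv_dL {T : Matrix (Fin k × Fin p) (Fin k × Fin p) 𝕜} (hT : T.det ≠ 0) (v : E 𝕜 k p) :
    dL T⁻¹ (dL T v) = v := by
  rw [dL_dL, Matrix.nonsing_inv_mul _ (isUnit_iff_ne_zero.2 hT), dL_one]

lemma dL_dL_inv {T : Matrix (Fin k × Fin p) (Fin k × Fin p) 𝕜} (hT : T.det ≠ 0) (v : E 𝕜 k p) :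
    dL T (dL T⁻¹ v) = v := by
  rw [dL_dL, Matrix.mul_nonsing_inv _ (isUnit_iff_ne_zero.2 hT), dL_one]

/-- The inverse in the second component, as an element of the vector space `E`. -/
def invE (e : E 𝕜 k p) : E 𝕜 k p := pair 0 (sndM e)⁻¹

lemma contDiffAt_invE (g : G 𝕜 k p) : ContDiffAt 𝕜 ∞ (invE : E 𝕜 k p → E 𝕜 k p) g.toE :=
  ContDiffAt.prodMk contDiffAt_const (contDiffAt_pi.2 fun i => contDiffAt_pi.2 fun j =>
    G.contDiffAt_inv_sndM g.toE (det_sndM_toE_ne_zero g) i j)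

lemma mulE_invE (e v : E 𝕜 k p) : mulE (invE e) v = dL (sndM e)⁻¹ v := rfl

lemma contDiffAt_dL_inv (g : G 𝕜 k p) {Y : E 𝕜 k p → E 𝕜 k p} (hY : ContDiffAt 𝕜 ∞ Y g.toE) :
    ContDiffAt 𝕜 ∞ (fun e => dL (sndM e)⁻¹ (Y e)) g.toE := by
  simp only [← mulE_invE, ← mulCLM_apply]
  exact (((mulCLM 𝕜 k p).contDiff.contDiffAt).comp g.toE (contDiffAt_invE g)).clm_apply hY

/-- Differentiate the identity `e (e⁻¹ w) = w`, valid near `g`, and solve for the derivative of `e⁻¹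
w`. -/
lemma fderiv_dL_inv (g : G 𝕜 k p) (v w : E 𝕜 k p) :
    fderiv 𝕜 (fun e : E 𝕜 k p => dL (sndM e)⁻¹ w) g.toE v =
      -mulE (dL (sndM g.toE)⁻¹ v) (dL (sndM g.toE)⁻¹ w) := by
  set f : E 𝕜 k p → E 𝕜 k p := fun e => dL (sndM e)⁻¹ w with hf
  have hd : DifferentiableAt 𝕜 f g.toE :=
    (contDiffAt_dL_inv g contDiffAt_const).differentiableAt (by simp)
  have h1 : HasFDerivAt (fun e => mulCLM 𝕜 k p e (f e)) _ g.toE :=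
    (mulCLM 𝕜 k p).hasFDerivAt.clm_apply hd.hasFDerivAt
  have h2 : HasFDerivAt (fun e => mulCLM 𝕜 k p e (f e)) (0 : E 𝕜 k p →L[𝕜] E 𝕜 k p) g.toE := by
    refine (hasFDerivAt_const w g.toE).congr_of_eventuallyEq ?_
    filter_upwards [eventually_det_ne_zero g] with e he
    exact dL_dL_inv he w
  have h3 := congrArg (fun A : E 𝕜 k p →L[𝕜] E 𝕜 k p => dL (sndM g.toE)⁻¹ (A v)) (h1.unique h2)
  simp only [add_apply, ContinuousLinearMap.comp_apply,
    ContinuousLinearMap.flip_apply, zero_apply, map_zero, map_add] at h3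
  rw [mulCLM_apply, mulE_apply, dL_inv_dL (det_sndM_toE_ne_zero g)] at h3
  rw [eq_neg_of_add_eq_zero_left h3]
  simp [mulCLM_apply, mulE_apply, dL_dL, hf, Matrix.mul_assoc]

/-- `leftForm` as a linear function of the inverse of the second component. -/
def leftFormLin (α : E 𝕜 k p →ₗ[𝕜] 𝕜) : E 𝕜 k p →ₗ[𝕜] (E 𝕜 k p [⋀^Fin 1]→L[𝕜] 𝕜) where
  toFun e := ContinuousAlternatingMap.ofSubsingleton 𝕜 (E 𝕜 k p) 𝕜 (0 : Fin 1)
    (LinearMap.toContinuousLinearMap (α ∘ₗ dL (sndM e)))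
  map_add' a b := by ext v; simp [dL_add_left]
  map_smul' c a := by ext v; simp [dL_smul_left]

lemma contDiffAt_leftForm (α : E 𝕜 k p →ₗ[𝕜] 𝕜) (g : G 𝕜 k p) :
    ContDiffAt 𝕜 ∞ (leftForm α) g.toE := by
  have h : leftForm α = LinearMap.toContinuousLinearMap (leftFormLin α) ∘ invE := rfl
  rw [h]
  exact ContDiffAt.comp g.toE (ContinuousLinearMap.contDiff _).contDiffAt (contDiffAt_invE g)

/-- The exterior derivative is evaluated on constant fields of `E`, so that only the derivatives of
`e ↦ α (e⁻¹ w)` and `e ↦ α (e⁻¹ v)` enter; their difference is a commutator. -/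
lemma dLeftForm_apply (α : E 𝕜 k p →ₗ[𝕜] 𝕜) (g : G 𝕜 k p) (v w : E 𝕜 k p) :
    dLeftForm α g.toE ![v, w] =
      -α (bracketE (dL (sndM g.toE)⁻¹ v) (dL (sndM g.toE)⁻¹ w)) := by
  have key : ∀ v w : E 𝕜 k p, fderiv 𝕜 (fun e : E 𝕜 k p => α (dL (sndM e)⁻¹ w)) g.toE v =
      -α (mulE (dL (sndM g.toE)⁻¹ v) (dL (sndM g.toE)⁻¹ w)) := fun v w => by
    have hd : DifferentiableAt 𝕜 (fun e : E 𝕜 k p => dL (sndM e)⁻¹ w) g.toE :=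
      (contDiffAt_dL_inv g contDiffAt_const).differentiableAt (by simp)
    have := ((LinearMap.toContinuousLinearMap α).hasFDerivAt.comp g.toE hd.hasFDerivAt).fderiv
    have h2 := congrArg (fun A : E 𝕜 k p →L[𝕜] 𝕜 => A v) this
    simp only [ContinuousLinearMap.comp_apply, fderiv_dL_inv, map_neg] at h2
    exact h2
  rw [dLeftForm, extDeriv_apply ((contDiffAt_leftForm α g).differentiableAt (by simp))]
  refine (Fin.sum_univ_two _).trans ?_
  change _ • fderiv 𝕜 (fun e : E 𝕜 k p => α (dL (sndM e)⁻¹ w)) g.toE v +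
    _ • fderiv 𝕜 (fun e : E 𝕜 k p => α (dL (sndM e)⁻¹ v)) g.toE w = _
  rw [key, key, bracketE, map_sub]
  simp
  ring

lemma dLeftForm_one_apply (α : E 𝕜 k p →ₗ[𝕜] 𝕜) (v w : E 𝕜 k p) :
    dLeftForm α (1 : G 𝕜 k p).toE ![v, w] = -α (bracketE v w) := by
  rw [dLeftForm_apply]; simp

/-- Closedness is `d² = 0`, and translation to the neutral element reduces nondegeneracy to that of
`(x, y) ↦ α [x, y]`. -/
lemma dLeftForm_isLeftInvariantSymplectic {α : E 𝕜 k p →ₗ[𝕜] 𝕜}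
    (h : ∀ x, (∀ y, α (bracketE x y) = 0) → x = 0) :
    IsLeftInvariantSymplectic (dLeftForm α) where
  smooth := by
    rintro _ ⟨g, rfl⟩
    have h1 : ContDiffAt 𝕜 ∞ (fderiv 𝕜 (leftForm α)) g.toE :=
      (contDiffAt_leftForm α g).fderiv_right (m := ∞) (by simp)
    exact ((ContinuousAlternatingMap.alternatizeUncurryFinCLM 𝕜 (E 𝕜 k p) 𝕜
      ).contDiff.contDiffAt.comp g.toE h1).contDiffWithinAt
  closed g := extDeriv_extDeriv_apply (contDiffAt_leftForm α g) 
    (by simpa using WithTop.coe_le_coe.2 (le_top : (2 : ℕ∞) ≤ ⊤))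
  nondegenerate g v hv := by
    have hg := det_sndM_toE_ne_zero g
    have := h (dL (sndM g.toE)⁻¹ v) fun y => by
      have := hv (dL (sndM g.toE) y)
      rwa [dLeftForm_apply, dL_inv_dL hg, neg_eq_zero] at this
    rw [← dL_dL_inv hg v, this, map_zero]
  leftInvariant g h v w := by
    have key : ∀ v, dL (sndM (g * h).toE)⁻¹ (dL g.T.val v) = dL (sndM h.toE)⁻¹ v := fun v => by
      rw [dL_dL]
      congr 2
      have := det_sndM_toE_ne_zero g
      simp only [sndM_toE, G.mul_T, Units.val_mul] at this ⊢
      rw [Matrix.mul_inv_rev, Matrix.mul_assoc,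
        Matrix.nonsing_inv_mul _ (isUnit_iff_ne_zero.2 this), Matrix.mul_one]
    rw [dLeftForm_apply, dLeftForm_apply, key, key]

lemma eq_zero_of_isLeftInvariantSymplectic {α : E 𝕜 k p →ₗ[𝕜] 𝕜}
    (h : IsLeftInvariantSymplectic (dLeftForm α)) {x : E 𝕜 k p}
    (hx : ∀ y, α (bracketE x y) = 0) : x = 0 :=
  h.nondegenerate 1 x fun w => by rw [dLeftForm_one_apply, hx, neg_zero]

/-- The bilinear form `(x, y) ↦ α [x, y]` of a linear form `α` on the Lie algebra. -/
def bracketForm (α : E 𝕜 k p →ₗ[𝕜] 𝕜) : E 𝕜 k p →ₗ[𝕜] Module.Dual 𝕜 (E 𝕜 k p) :=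
  LinearMap.mk₂ 𝕜 (fun x y => α (bracketE x y))
    (fun x y z => by simp only [bracketE, mulE_add, add_mulE, map_add, map_sub]; ring)
    (fun c x z => by simp only [bracketE, mulE_smul, smul_mulE, map_smul, map_sub, smul_sub])
    (fun x y z => by simp only [bracketE, mulE_add, add_mulE, map_add, map_sub]; ring)
    (fun c x z => by simp only [bracketE, mulE_smul, smul_mulE, map_smul, map_sub, smul_sub])

lemma bracketForm_apply (α : E 𝕜 k p →ₗ[𝕜] 𝕜) (x y : E 𝕜 k p) :
    bracketForm α x y = α (bracketE x y) := rfl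

/-! ### The connection and Lagrangian subspaces of a symplectic form -/

section Symplectic

variable {α : E 𝕜 k p →ₗ[𝕜] 𝕜} (hα : IsLeftInvariantSymplectic (dLeftForm α))

include hα in
lemma ext_bracketE {x y : E 𝕜 k p} (h : ∀ z, α (bracketE x z) = α (bracketE y z)) : x = y := by
  refine sub_eq_zero.1 (eq_zero_of_isLeftInvariantSymplectic hα fun z => ?_)
  rw [← bracketForm_apply, map_sub, LinearMap.sub_apply, bracketForm_apply, bracketForm_apply, h,
    sub_self]

include hα in
lemma bracketForm_surjective : Function.Surjective (bracketForm α) := by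
  refine (LinearMap.injective_iff_surjective_of_finrank_eq_finrank
    (Subspace.dual_finrank_eq).symm).1 fun x y h => ext_bracketE hα fun z => ?_
  rw [← bracketForm_apply, h, bracketForm_apply]

include hα in
-- `symProd` is a choice, so its defining identity requires existence. This comes from
-- nondegeneracy, which in finite dimension makes `bracketForm α` onto the dual.
lemma bracketE_symProd (x y z : E 𝕜 k p) :
    α (bracketE (symProd (dLeftForm α) x y) z) = -α (bracketE y (bracketE x z)) := by
  have h : ∃ w : E 𝕜 k p, ∀ z : E 𝕜 k p,
      dLeftForm α (1 : G 𝕜 k p).toE ![w, z] = - dLeftForm α (1 : G 𝕜 k p).toE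
        ![y, VectorField.lieBracket 𝕜 (leftField x) (leftField z) (1 : G 𝕜 k p).toE] := by
    obtain ⟨w, hw⟩ := bracketForm_surjective hα
      (-(bracketForm α y ∘ₗ (LinearMap.mk (⟨fun z => bracketE x z, fun a b => by
        simp only [bracketE, mulE_add, add_mulE]; abel⟩) fun c a => by
        simp only [bracketE, mulE_smul, smul_mulE, smul_sub, RingHom.id_apply])))
    refine ⟨w, fun z => ?_⟩
    have := LinearMap.congr_fun hw z
    rw [lieBracket_leftField, dLeftForm_one_apply, dLeftForm_one_apply, leftField]
    simp only [sndM_toE, G.one_T, Units.val_one, dL_one]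
    rw [← bracketForm_apply, this]
    rfl
  have := Classical.epsilon_spec h z
  rw [lieBracket_leftField, dLeftForm_one_apply, dLeftForm_one_apply, leftField] at this
  simp only [sndM_toE, G.one_T, Units.val_one, dL_one, neg_neg] at this
  rw [symProd, ← this, neg_neg]

lemma conn_congr (Ω : E 𝕜 k p → E 𝕜 k p [⋀^Fin 2]→L[𝕜] 𝕜) {X X' Y Y' : E 𝕜 k p → E 𝕜 k p}
    {e : E 𝕜 k p} (hX : X e = X' e) (hY : Y =ᶠ[𝓝 e] Y') : conn Ω X Y e = conn Ω X' Y' e := by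
  have h : (fun e' : E 𝕜 k p => dL (sndM e')⁻¹ (Y e')) =ᶠ[𝓝 e]
      fun e' : E 𝕜 k p => dL (sndM e')⁻¹ (Y' e') := by
    filter_upwards [hY] with e' he' using by rw [he']
  rw [conn, conn, h.fderiv_eq, hX, hY.self_of_nhds]

lemma conn_leftField (Ω : E 𝕜 k p → E 𝕜 k p [⋀^Fin 2]→L[𝕜] 𝕜) (x y : E 𝕜 k p) {e : E 𝕜 k p}
    (he : (sndM e).det ≠ 0) :
    conn Ω (leftField x) (leftField y) e = leftField (symProd Ω x y) e := by
  obtain ⟨g, rfl⟩ := exists_toE_eq he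
  have h : (fun e' : E 𝕜 k p => dL (sndM e')⁻¹ (leftField y e')) =ᶠ[𝓝 g.toE] fun _ => y := by
    filter_upwards [eventually_det_ne_zero g] with e' he' using dL_inv_dL he' y
  rw [conn, h.fderiv_eq, leftField, leftField, leftField, dL_inv_dL he, dL_inv_dL he]
  simp

include hα in
-- On left-invariant fields the claims read `x y - y x = [x, y]` and `x (y z) - y (x z) = [x, y] z`.
-- Pairing with an arbitrary vector through `α [·, ·]` turns each into the Jacobi identity.
lemma isAffineStructure_dLeftForm : IsAffineStructure (dLeftForm α) where
  torsion_free x y g := by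
    have hg := det_sndM_toE_ne_zero g
    rw [conn_leftField _ _ _ hg, conn_leftField _ _ _ hg, lieBracket_leftField, leftField,
      leftField, leftField, ← map_sub]
    congr 1
    refine ext_bracketE hα fun z => ?_
    rw [← bracketForm_apply, map_sub, LinearMap.sub_apply, bracketForm_apply, bracketForm_apply,
      bracketE_symProd hα, bracketE_symProd hα, bracketE_jacobi, map_sub]
    ring
  flat x y z g := by
    have hg := det_sndM_toE_ne_zero g
    have key : ∀ x y z : E 𝕜 k p, conn (dLeftForm α) (leftField x)
        (conn (dLeftForm α) (leftField y) (leftField z)) g.toE =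
        leftField (symProd (dLeftForm α) x (symProd (dLeftForm α) y z)) g.toE := fun x y z => by
      rw [← conn_leftField _ _ _ hg]
      refine conn_congr _ rfl ?_
      filter_upwards [eventually_det_ne_zero g] with e he using conn_leftField _ _ _ he
    rw [key, key, lieBracket_leftField, conn_leftField _ _ _ hg, leftField,
      leftField, leftField, ← map_sub]
    congr 1
    refine ext_bracketE hα fun w => ?_
    rw [← bracketForm_apply, map_sub, LinearMap.sub_apply, bracketForm_apply, bracketForm_apply]
    simp only [bracketE_symProd hα]
    rw [bracketE_jacobi, show ∀ u v : E 𝕜 k p, bracketE z (u - v) = bracketE z u - bracketE z v from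
      fun u v => by simp only [bracketE, mulE_sub, sub_mulE]; abel, map_sub]
    ring

/-- A subspace closed under the bracket and isotropic is closed under the symplectic product as
soon as it is equal to its orthogonal. -/
lemma symProd_mem {h : Submodule 𝕜 (E 𝕜 k p)} (hα : IsLeftInvariantSymplectic (dLeftForm α))
    (hb : ∀ x ∈ h, ∀ y ∈ h, bracketE x y ∈ h)
    (hl : ∀ x, x ∈ h ↔ ∀ y ∈ h, α (bracketE x y) = 0) {x y : E 𝕜 k p} (hx : x ∈ h) (hy : y ∈ h) :
    symProd (dLeftForm α) x y ∈ h := by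
  rw [hl]
  intro z hz
  rw [bracketE_symProd hα, (hl y).1 hy _ (hb x hx z hz), neg_zero]

include hα in
/-- Two complementary isotropic subspaces are equal to their own orthogonals. -/
lemma mem_iff_of_isCompl_of_isotropic {h h' : Submodule 𝕜 (E 𝕜 k p)} (hc : IsCompl h h')
    (h1 : ∀ x ∈ h, ∀ y ∈ h, α (bracketE x y) = 0)
    (h2 : ∀ x ∈ h', ∀ y ∈ h', α (bracketE x y) = 0) (x : E 𝕜 k p) :
    x ∈ h ↔ ∀ y ∈ h, α (bracketE x y) = 0 := by
  refine ⟨h1 x, fun hx => ?_⟩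
  obtain ⟨a, ha, b, hb, rfl⟩ := Submodule.mem_sup.1 (hc.sup_eq_top ▸ Submodule.mem_top (x := x))
  suffices b = 0 by simpa [this] using ha
  refine eq_zero_of_isLeftInvariantSymplectic hα fun y => ?_
  obtain ⟨c, hc', d, hd, rfl⟩ := Submodule.mem_sup.1 (hc.sup_eq_top ▸ Submodule.mem_top (x := y))
  have e1 := hx c hc'
  rw [← bracketForm_apply, map_add, LinearMap.add_apply, bracketForm_apply, h1 a ha c hc',
    zero_add] at e1
  rw [← bracketForm_apply, map_add, e1, bracketForm_apply, h2 b hb d hd, zero_add]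

end Symplectic

/-! ### Linear forms as pairs `(H, N)`, and the standard form -/

section Standard

lemma linForm_bracketE (H : Matrix (Fin p) (Fin k × Fin p) 𝕜)
    (N : Matrix (Fin k × Fin p) (Fin k × Fin p) 𝕜) (a b : E 𝕜 k p) :
    linForm H N (bracketE a b) = (H * sndM a * fstM b).trace +
      ((N * sndM a - sndM a * N - fstM a * H) * sndM b).trace := by
  change ((sndM a * fstM b - sndM b * fstM a) * H).trace +
    (N * (sndM a * sndM b - sndM b * sndM a)).trace = _
  simp only [Matrix.sub_mul, Matrix.mul_sub, Matrix.trace_sub]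
  rw [Matrix.trace_mul_comm (sndM a * fstM b) H, Matrix.mul_assoc (sndM b),
    Matrix.trace_mul_comm (sndM b), ← Matrix.mul_assoc N (sndM b),
    Matrix.trace_mul_comm (N * sndM b) (sndM a)]
  simp only [Matrix.mul_assoc]
  ring

/-- Testing on `b = (y, 0)` and on `b = (0, v)` separates the two conditions, since the trace
pairing is nondegenerate. -/
lemma linForm_bracketE_eq_zero_iff (H : Matrix (Fin p) (Fin k × Fin p) 𝕜)
    (N : Matrix (Fin k × Fin p) (Fin k × Fin p) 𝕜) (a : E 𝕜 k p) :
    (∀ b, linForm H N (bracketE a b) = 0) ↔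
      H * sndM a = 0 ∧ N * sndM a - sndM a * N = fstM a * H := by
  simp only [linForm_bracketE]
  constructor
  · intro h
    constructor
    · rw [Matrix.ext_iff_trace_mul_right]
      intro x
      simpa using h (pair x 0)
    · rw [← sub_eq_zero, Matrix.ext_iff_trace_mul_right]
      intro x
      simpa using h (pair 0 x)
  · rintro ⟨h1, h2⟩ b
    rw [h1, h2]
    simp

lemma exists_eq_linForm (α : E 𝕜 k p →ₗ[𝕜] 𝕜) : ∃ H N, α = linForm H N := by
  classical
  refine ⟨Matrix.of fun i b => α (pair (Matrix.single b i 1) 0),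
    Matrix.of fun a b => α (pair 0 (Matrix.single b a 1)), ?_⟩
  have h1 : ∀ b i, α (pair (Matrix.single b i 1) 0) = linForm (Matrix.of fun i b =>
      α (pair (Matrix.single b i 1) 0)) (Matrix.of fun a b => α (pair 0 (Matrix.single b a 1)))
      (pair (Matrix.single b i 1) 0) := fun b i => by
    simp [linForm, Matrix.trace_single_mul]
  have h2 : ∀ b i, α (pair 0 (Matrix.single b i 1)) = linForm (Matrix.of fun i b =>
      α (pair (Matrix.single b i 1) 0)) (Matrix.of fun a b => α (pair 0 (Matrix.single b a 1)))
      (pair 0 (Matrix.single b i 1)) := fun b i => by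
    simp [linForm, Matrix.trace_mul_single]
  have e1 : ∀ b i, (pair (Matrix.single b i 1) 0 : E 𝕜 k p) =
      (Pi.single b (Pi.single i 1), 0) := fun b i => by
    rw [Matrix.single_eq_of_single_single]; rfl
  have e2 : ∀ b i, (pair 0 (Matrix.single b i 1) : E 𝕜 k p) =
      (0, Pi.single b (Pi.single i 1)) := fun b i => by
    rw [Matrix.single_eq_of_single_single]; rfl
  ext1
  · ext b i
    have := h1 b i
    rw [e1 b i] at this
    exact this
  · ext b i
    have := h2 b i
    rw [e2 b i] at this
    exact this

/-- `α₀` sees only the last block of `x` and the blocks of `u` just above the diagonal. -/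
lemma α₀_eq_zero {a : E 𝕜 k p} (h1 : ∀ b i, b.1.val + 1 = k → fstM a b i = 0)
    (h2 : ∀ b c : Fin k × Fin p, c.1.val = b.1.val + 1 → sndM a b c = 0) : α₀ 𝕜 k p a = 0 := by
  change (fstM a * H₀ 𝕜 k p).trace + (N₀ 𝕜 k p * sndM a).trace = 0
  simp only [Matrix.trace, Matrix.diag_apply, Matrix.mul_apply, H₀, N₀, Matrix.of_apply]
  rw [Finset.sum_eq_zero fun b _ => Finset.sum_eq_zero fun i _ => ?_,
    Finset.sum_eq_zero fun b _ => Finset.sum_eq_zero fun c _ => ?_, add_zero]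
  · split_ifs with h
    · rw [h2 c b h.1, mul_zero]
    · rw [zero_mul]
  · split_ifs with h
    · rw [h1 b i h.1, zero_mul]
    · rw [mul_zero]

lemma mulE_mem_L {a b : E 𝕜 k p} (ha : a ∈ L 𝕜 k p) (hb : b ∈ L 𝕜 k p) :
    mulE a b ∈ L 𝕜 k p := fun i j hij => by
  rw [sndM_mulE, Matrix.mul_apply]
  refine Finset.sum_eq_zero fun c _ => ?_
  rcases le_or_gt c.1 i.1 with h | h
  · rw [ha i c h, zero_mul]
  · rw [hb c j (hij.trans h.le), mul_zero]

lemma mulE_mem_L' {a b : E 𝕜 k p} (ha : a ∈ L' 𝕜 k p) (hb : b ∈ L' 𝕜 k p) :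
    mulE a b ∈ L' 𝕜 k p := by
  refine ⟨by simp [hb.1], fun i j hij => ?_⟩
  rw [sndM_mulE, Matrix.mul_apply]
  refine Finset.sum_eq_zero fun c _ => ?_
  rcases lt_or_ge i.1 c.1 with h | h
  · rw [ha.2 i c h, zero_mul]
  · rw [hb.2 c j (h.trans_lt hij), mul_zero]

/-- A product of two strictly upper triangular block matrices also vanishes just above the diagonal,
and the zero last block row of `a` kills the last block of the vector part. -/
lemma α₀_mulE_eq_zero_of_mem_L {a b : E 𝕜 k p} (ha : a ∈ L 𝕜 k p) (hb : b ∈ L 𝕜 k p) :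
    α₀ 𝕜 k p (mulE a b) = 0 := by
  refine α₀_eq_zero (fun c i hc => ?_) fun c d hcd => ?_
  · rw [fstM_mulE, Matrix.mul_apply]
    refine Finset.sum_eq_zero fun d _ => ?_
    rw [ha c d (Fin.le_def.2 (by have := d.1.2; omega)), zero_mul]
  · rw [sndM_mulE, Matrix.mul_apply]
    refine Finset.sum_eq_zero fun f _ => ?_
    rcases le_or_gt f.1 c.1 with h | h
    · rw [ha c f h, zero_mul]
    · rw [hb f d (Fin.le_def.2 (by have := Fin.lt_def.1 h; omega)), mul_zero]

lemma α₀_eq_zero_of_mem_L' {a : E 𝕜 k p} (ha : a ∈ L' 𝕜 k p) : α₀ 𝕜 k p a = 0 :=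
  α₀_eq_zero (fun c i _ => by rw [ha.1, Matrix.zero_apply]) fun c d hcd =>
    ha.2 c d (Fin.lt_def.2 (by omega))

lemma isCompl_L_L' : IsCompl (L 𝕜 k p) (L' 𝕜 k p) := by
  rw [isCompl_iff, Submodule.disjoint_def, codisjoint_iff, Submodule.eq_top_iff']
  constructor
  · intro a ha ha'
    refine ext_fstM_sndM ha'.1 ?_
    ext i j
    rcases le_or_gt j.1 i.1 with h | h
    · exact ha i j h
    · exact ha'.2 i j h
  · intro a
    rw [Submodule.mem_sup]
    refine ⟨pair (fstM a) (Matrix.of fun i j => if j.1 ≤ i.1 then 0 else sndM a i j), ?_,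
      pair 0 (Matrix.of fun i j => if j.1 ≤ i.1 then sndM a i j else 0), ?_, ?_⟩
    · intro i j hij
      simp [hij]
    · refine ⟨rfl, fun i j hij => ?_⟩
      simp [hij]
    · refine ext_fstM_sndM (by simp) ?_
      ext i j
      by_cases h : j.1 ≤ i.1 <;> simp [h]

lemma H₀_mul_apply {ι : Type*} (M : Matrix (Fin k × Fin p) ι 𝕜) {l : Fin k} (hl : l.val + 1 = k)
    (i : Fin p) (b : ι) : (H₀ 𝕜 k p * M) i b = M (l, i) b := by
  rw [Matrix.mul_apply, Finset.sum_eq_single (l, i)]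
  · simp [H₀, hl]
  · intro c _ hc
    rw [H₀, Matrix.of_apply, if_neg, zero_mul]
    rintro ⟨h1, h2⟩
    exact hc (Prod.ext (Fin.ext (show c.1.val = l.val by omega)) h2.symm)
  · simp

lemma mul_H₀_apply {ι : Type*} (x : Matrix ι (Fin p) 𝕜) (a : ι) (b : Fin k × Fin p) :
    (x * H₀ 𝕜 k p) a b = if b.1.val + 1 = k then x a b.2 else 0 := by
  rw [Matrix.mul_apply, Finset.sum_eq_single b.2]
  · by_cases h : b.1.val + 1 = k <;> simp [H₀, h]
  · intro c _ hc
    simp [H₀, hc]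
  · simp

lemma N₀_mul_apply_succ {ι : Type*} (M : Matrix (Fin k × Fin p) ι 𝕜) {a a' : Fin k}
    (h : a'.val = a.val + 1) (i : Fin p) (b : ι) : (N₀ 𝕜 k p * M) (a', i) b = M (a, i) b := by
  rw [Matrix.mul_apply, Finset.sum_eq_single (a, i)]
  · simp [N₀, h]
  · intro c _ hc
    rw [N₀, Matrix.of_apply, if_neg, zero_mul]
    rintro ⟨h1, h2⟩
    exact hc (Prod.ext (Fin.ext (show c.1.val = a.val by simp only at h1; omega)) h2.symm)
  · simp

lemma N₀_mul_apply_zero {ι : Type*} (M : Matrix (Fin k × Fin p) ι 𝕜) {a : Fin k}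
    (h : a.val = 0) (i : Fin p) (b : ι) : (N₀ 𝕜 k p * M) (a, i) b = 0 := by
  rw [Matrix.mul_apply]
  exact Finset.sum_eq_zero fun c _ => by simp [N₀, h]

lemma mul_N₀_apply_succ {ι : Type*} (M : Matrix ι (Fin k × Fin p) 𝕜) {b b' : Fin k}
    (h : b'.val = b.val + 1) (a : ι) (i : Fin p) : (M * N₀ 𝕜 k p) a (b, i) = M a (b', i) := by
  rw [Matrix.mul_apply, Finset.sum_eq_single (b', i)]
  · simp [N₀, h]
  · intro c _ hc
    rw [N₀, Matrix.of_apply, if_neg, mul_zero]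
    rintro ⟨h1, h2⟩
    exact hc (Prod.ext (Fin.ext (show c.1.val = b'.val by simp only at h1; omega)) h2)
  · simp

/-- The relation `N₀ u - u N₀ = x H₀`, read outside the last block column, makes the blocks of `u`
constant along diagonals and kills the first block row beyond its first block; `H₀ u = 0` kills the
last block row. Every diagonal meets one of these zero blocks, so `u = 0`, and then `x H₀ = 0` gives
`x = 0`. -/
lemma eq_zero_of_α₀_bracketE {a : E 𝕜 k p} (h : ∀ b, α₀ 𝕜 k p (bracketE a b) = 0) : a = 0 := by
  obtain ⟨h1, h2⟩ := (linForm_bracketE_eq_zero_iff _ _ a).1 h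
  have hlast : ∀ (c d : Fin k × Fin p), c.1.val + 1 = k → sndM a c d = 0 := fun c d hc => by
    rw [← Prod.mk.eta (p := c), ← H₀_mul_apply (sndM a) hc, h1, Matrix.zero_apply]
  have hdiag : ∀ (c d c' d' : Fin k) (i j : Fin p), c'.val = c.val + 1 → d'.val = d.val + 1 →
      sndM a (c, i) (d, j) = sndM a (c', i) (d', j) := fun c d c' d' i j hc hd => by
    have := congrFun (congrFun h2 (c', i)) (d, j)
    rw [Matrix.sub_apply, N₀_mul_apply_succ _ hc, mul_N₀_apply_succ _ hd, mul_H₀_apply, if_neg,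
      sub_eq_zero] at this
    · exact this
    · have := d'.2
      simp only
      omega
  have hfirst : ∀ (c d : Fin k × Fin p), c.1.val = 0 → 0 < d.1.val → sndM a c d = 0 :=
      fun c d hc hd => by
    have := congrFun (congrFun h2 c) (⟨d.1.val - 1, by omega⟩, d.2)
    rw [Matrix.sub_apply, ← Prod.mk.eta (p := c), N₀_mul_apply_zero _ hc,
      mul_N₀_apply_succ (b' := d.1) _ (by simp only; omega), mul_H₀_apply, if_neg, zero_sub,
      neg_eq_zero] at this
    · exact this
    · have := d.1.2
      simp only
      omega
  -- On or below the diagonal: move down along the diagonal to the last block row, `n` being the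
  -- number of moves.
  have hle : ∀ (n : ℕ) (c d : Fin k × Fin p), c.1.val + n + 1 = k → d.1 ≤ c.1 →
      sndM a c d = 0 := by
    intro n
    induction n with
    | zero => exact fun c d hc _ => hlast c d hc
    | succ n ih =>
      intro c d hc hd
      have hd' := Fin.le_def.1 hd
      rw [← Prod.mk.eta (p := c), ← Prod.mk.eta (p := d),
        hdiag c.1 d.1 ⟨c.1.val + 1, by omega⟩ ⟨d.1.val + 1, by omega⟩ _ _ rfl rfl]
      exact ih _ _ (by simp only; omega) (Fin.le_def.2 (by simp only; omega))
  -- Above the diagonal: move up to the first block row.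
  have hlt : ∀ (n : ℕ) (c d : Fin k × Fin p), c.1.val = n → c.1 < d.1 → sndM a c d = 0 := by
    intro n
    induction n with
    | zero => exact fun c d hc hd => hfirst c d hc (by have := Fin.lt_def.1 hd; omega)
    | succ n ih =>
      intro c d hc hd
      have hd' := Fin.lt_def.1 hd
      rw [← Prod.mk.eta (p := c), ← Prod.mk.eta (p := d),
        ← hdiag ⟨c.1.val - 1, by omega⟩ ⟨d.1.val - 1, by omega⟩ c.1 d.1 _ _
          (by simp only; omega) (by simp only; omega)]
      exact ih _ _ (by simp only; omega) (Fin.lt_def.2 (by simp only; omega))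
  have hsnd : sndM a = 0 := by
    ext c d
    rcases le_or_gt d.1 c.1 with h | h
    · exact hle (k - 1 - c.1.val) c d (by have := c.1.2; omega) h
    · exact hlt _ c d rfl h
  refine ext_fstM_sndM ?_ hsnd
  ext c i
  have hk : 0 < k := c.1.pos
  have := congrFun (congrFun h2 c) (⟨k - 1, by omega⟩, i)
  rw [mul_H₀_apply, if_pos (by simp only; omega), hsnd] at this
  simpa using this.symm

lemma isLeftInvariantSymplectic_α₀ : IsLeftInvariantSymplectic (dLeftForm (α₀ 𝕜 k p)) :=
  dLeftForm_isLeftInvariantSymplectic fun _ => eq_zero_of_α₀_bracketE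

end Standard

/-! ### Trivial radical implies observability in `k` steps -/

section Observability

variable {K V W S : Type*} [Field K] [AddCommGroup V] [Module K V] [AddCommGroup W] [Module K W]
  [AddCommGroup S] [Module K S]

lemma exists_comp_eq_of_ker_le (H : V →ₗ[K] W) (f : V →ₗ[K] S)
    (h : LinearMap.ker H ≤ LinearMap.ker f) : ∃ x : W →ₗ[K] S, x ∘ₗ H = f := by
  obtain ⟨s, hs⟩ := H.rangeRestrict.exists_rightInverse_of_surjective H.range_rangeRestrict
  obtain ⟨x, hx⟩ := LinearMap.exists_extend (f ∘ₗ s)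
  refine ⟨x, LinearMap.ext fun v => ?_⟩
  have h1 : x (H v) = f (s (H.rangeRestrict v)) := LinearMap.congr_fun hx (H.rangeRestrict v)
  have h2 : s (H.rangeRestrict v) - v ∈ LinearMap.ker H := by
    have := congrArg Subtype.val (LinearMap.congr_fun hs (H.rangeRestrict v))
    simpa [sub_eq_zero] using this
  rw [LinearMap.comp_apply, h1, ← sub_eq_zero, ← map_sub]
  exact h h2

/-- The annihilator of the linear form `(H, N)` with respect to the bracket is trivial. -/
def TrivialRadical (H : V →ₗ[K] W) (N : V →ₗ[K] V) : Prop :=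
  ∀ (u : V →ₗ[K] V) (x : W →ₗ[K] V), H ∘ₗ u = 0 → N ∘ₗ u - u ∘ₗ N = x ∘ₗ H → u = 0 ∧ x = 0

variable [FiniteDimensional K V] [FiniteDimensional K W] {H : V →ₗ[K] W} {N : V →ₗ[K] V}

lemma TrivialRadical.ne_zero [Nontrivial V] [Nontrivial W] (h : TrivialRadical H N) : H ≠ 0 := by
  rintro rfl
  obtain ⟨x, hx⟩ := exists_ne (0 : W →ₗ[K] V)
  exact hx (h 0 x (by simp) (by simp)).2

/-- If the radical is trivial, the pair `(H, N)` is observable. -/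
lemma TrivialRadical.observable [Nontrivial V] [Nontrivial W] (h : TrivialRadical H N) {ξ : V}
    (hξ : ∀ i, H ((N ^ i) ξ) = 0) : ξ = 0 := by
  by_contra hne
  -- `S` is the unobservable subspace. A nonzero `u` with values in `S` satisfies `H u = 0`
  -- automatically, so it only has to make `N u - u N` vanish on `ker H`, that is, factor through
  -- `H`.
  let S : Submodule K V := ⨅ i, LinearMap.ker (H ∘ₗ N ^ i)
  have hS : ∀ v, v ∈ S ↔ ∀ i, H ((N ^ i) v) = 0 := fun v => by simp [S]
  have hNS : ∀ v ∈ S, N v ∈ S := fun v hv => (hS _).2 fun i => by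
    have := (hS v).1 hv (i + 1)
    rwa [pow_succ, Module.End.mul_apply] at this
  let Θ : (V →ₗ[K] S) →ₗ[K] (LinearMap.ker H →ₗ[K] S) :=
    { toFun := fun u => (N.restrict hNS ∘ₗ u - u ∘ₗ N) ∘ₗ (LinearMap.ker H).subtype
      map_add' := fun u v => by ext; simp; abel
      map_smul' := fun c u => by ext; simp [smul_sub] }
  have hSpos : 0 < Module.finrank K S := by
    rw [Module.finrank_pos_iff_exists_ne_zero]
    exact ⟨⟨ξ, (hS ξ).2 hξ⟩, fun h0 => hne (congrArg Subtype.val h0)⟩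
  have hker : Module.finrank K (LinearMap.ker H) < Module.finrank K V :=
    Submodule.finrank_lt fun h0 => h.ne_zero (LinearMap.ker_eq_top.1 h0)
  -- Dimension count: `dim ker H < dim V` because `H ≠ 0`, and `dim S > 0`.
  have hΘ : LinearMap.ker Θ ≠ ⊥ := LinearMap.ker_ne_bot_of_finrank_lt (by
    rw [Module.finrank_linearMap, Module.finrank_linearMap]
    exact Nat.mul_lt_mul_of_pos_right hker hSpos)
  obtain ⟨u, hu, hu0⟩ := Submodule.exists_mem_ne_zero_of_ne_bot hΘ
  obtain ⟨x, hx⟩ := exists_comp_eq_of_ker_le H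
    (N ∘ₗ (S.subtype ∘ₗ u) - (S.subtype ∘ₗ u) ∘ₗ N) fun v hv => by
      have := congrArg Subtype.val (LinearMap.congr_fun (LinearMap.mem_ker.1 hu) ⟨v, hv⟩)
      simpa [Θ] using this
  have h1 := (h (S.subtype ∘ₗ u) x (LinearMap.ext fun v => by
    simpa using (hS _).1 (u v).2 0) hx.symm).1
  exact hu0 (LinearMap.ext fun v => Subtype.ext (LinearMap.congr_fun h1 v))

/-- If the radical is trivial, the observability indices are all at most `k`. -/
lemma TrivialRadical.eq_zero [Nontrivial V] [Nontrivial W] (h : TrivialRadical H N) {k : ℕ}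
    (hk : Module.finrank K V = k * Module.finrank K W) {ξ : V}
    (hξ : ∀ i < k, H ((N ^ i) ξ) = 0) : ξ = 0 := by
  by_contra hne
  -- `O` is an endomorphism up to dimension, so its kernel vector `ξ` forces a nonzero form `f` on
  -- the target that kills the range: a relation `∑ q i ∘ H ∘ N ^ i = 0`.
  let O : V →ₗ[K] (Fin k → W) := LinearMap.pi fun i => H ∘ₗ N ^ i.val
  have hOinj : ¬ Function.Injective O := fun hi => hne (hi (by
    funext i
    simpa [O] using hξ i i.2))
  have hO : LinearMap.range O < ⊤ := by
    rw [lt_top_iff_ne_top, Ne, LinearMap.range_eq_top,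
      ← LinearMap.injective_iff_surjective_of_finrank_eq_finrank
        (by rw [hk, Module.finrank_pi_fintype]; simp)]
    exact hOinj
  obtain ⟨f, hf0, hf⟩ := Submodule.exists_le_ker_of_lt_top _ hO
  let q : ℕ → Module.Dual K W := fun i =>
    if hi : i < k then f ∘ₗ LinearMap.single K (fun _ => W) ⟨i, hi⟩ else 0
  have hq : ∀ v, ∑ i ∈ Finset.range k, q i (H ((N ^ i) v)) = 0 := fun v => by
    have h1 : f (O v) = 0 := hf ⟨v, rfl⟩
    rw [← LinearMap.sum_single_apply (fun _ => W) (O v), map_sum] at h1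
    rw [Finset.sum_range, ← h1]
    refine Finset.sum_congr rfl fun i _ => ?_
    simp [q, O]
  -- Horner tails of this relation: `t 0 = 0`, `t k = 0` and `t j = t (j + 1) ∘ N + q j ∘ H`.
  let t : ℕ → Module.Dual K V := fun j =>
    ∑ i ∈ Finset.range (k - j), q (i + j) ∘ₗ H ∘ₗ N ^ i
  have ht0 : t 0 = 0 := LinearMap.ext fun v => by simpa [t] using hq v
  have htk : t k = 0 := by simp [t]
  have htsucc : ∀ j < k, ∀ v, t j v = t (j + 1) (N v) + q j (H v) := fun j hj v => by
    simp only [t]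
    rw [show k - j = (k - (j + 1)) + 1 by omega, Finset.sum_range_succ']
    simp [pow_succ, LinearMap.sum_apply, add_assoc, add_comm 1 j]
  -- With `u = ∑ t (j + 1) ⊗ N ^ j ξ` and `x = ∑ q j ⊗ N ^ j ξ`, the recursion makes `N u - u N - x
  -- H` telescope to `t k ⊗ N ^ k ξ - t 0 ⊗ ξ = 0`, while `H u = 0` because `H N ^ j ξ = 0` for `j <
  -- k`. So `(x, u)` lies in the radical.
  let u : V →ₗ[K] V := ∑ j ∈ Finset.range k, (t (j + 1)).smulRight ((N ^ j) ξ)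
  let x : W →ₗ[K] V := ∑ j ∈ Finset.range k, (q j).smulRight ((N ^ j) ξ)
  have hx : x = 0 := by
    refine (h u x (LinearMap.ext fun v => ?_) (LinearMap.ext fun v => ?_)).2
    · simp only [u, LinearMap.comp_apply, LinearMap.sum_apply, map_sum,
        LinearMap.smulRight_apply, map_smul, LinearMap.zero_apply]
      exact Finset.sum_eq_zero fun i hi => by rw [hξ i (Finset.mem_range.1 hi), smul_zero]
    · simp only [u, x, LinearMap.sub_apply, LinearMap.comp_apply, LinearMap.sum_apply, map_sum,
        LinearMap.smulRight_apply, map_smul]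
      rw [← Finset.sum_sub_distrib, ← sub_eq_zero, ← Finset.sum_sub_distrib]
      have key : ∀ j ∈ Finset.range k, t (j + 1) v • N ((N ^ j) ξ) - t (j + 1) (N v) • (N ^ j) ξ -
          q j (H v) • (N ^ j) ξ = t (j + 1) v • (N ^ (j + 1)) ξ - t j v • (N ^ j) ξ := by
        intro j hj
        rw [htsucc j (Finset.mem_range.1 hj) v, pow_succ', Module.End.mul_apply, add_smul]
        abel
      rw [Finset.sum_congr rfl key,
        Finset.sum_range_sub (fun j => t j v • (N ^ j) ξ), ht0, htk]
      simp
  have hqne : ∃ i < k, q i ≠ 0 := by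
    by_contra! hall
    refine hf0 (LinearMap.pi_ext' fun i => ?_)
    have := hall i i.2
    simpa [q] using this
  obtain ⟨r, hr, hqr⟩ := hqne
  obtain ⟨w, hw⟩ : ∃ w, q r w ≠ 0 := by
    by_contra! hall
    exact hqr (LinearMap.ext hall)
  -- Evaluating `x = 0` at a `w` with `q r w ≠ 0` gives a nonzero polynomial of degree less than `k`
  -- with `P(N) ξ = 0`. Reduction modulo `P` expresses every `N ^ i ξ` by powers below `k`, so `ξ`
  -- is unobservable.
  let P : Polynomial K := ∑ j ∈ Finset.range k, Polynomial.monomial j (q j w)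
  have hPcoeff : P.coeff r = q r w := by
    simp [P, Polynomial.coeff_monomial, hr]
  have hP0 : P ≠ 0 := fun h0 => hw (by rw [← hPcoeff, h0, Polynomial.coeff_zero])
  have hPdeg : P.degree < k := by
    refine Polynomial.mem_degreeLT.1 (Submodule.sum_mem _ fun j hj => Polynomial.mem_degreeLT.2 ?_)
    exact (Polynomial.degree_monomial_le _ _).trans_lt (by exact_mod_cast Finset.mem_range.1 hj)
  have hPξ : Polynomial.aeval N P ξ = 0 := by
    have := LinearMap.congr_fun hx w
    simpa [P, x, Polynomial.aeval_monomial, LinearMap.sum_apply] using this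
  refine hne (h.observable fun i => ?_)
  have h1 : (N ^ i) ξ = Polynomial.aeval N (Polynomial.X ^ i % P) ξ := by
    have := EuclideanDomain.mod_add_div (Polynomial.X ^ i : Polynomial K) P
    have h2 := congrArg (fun Q => Polynomial.aeval N Q ξ) this
    simp only [map_add, map_mul, Polynomial.aeval_X_pow] at h2
    rw [← h2, ← map_mul, mul_comm P, map_mul, LinearMap.add_apply, Module.End.mul_apply, hPξ,
      map_zero, add_zero]
  have h2 : (Polynomial.X ^ i % P).degree < (k : WithBot ℕ) :=
    (EuclideanDomain.mod_lt (Polynomial.X ^ i) hP0).trans hPdeg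
  have h3 : (Polynomial.X ^ i % P).natDegree < k ∨ Polynomial.X ^ i % P = 0 := by
    by_cases h0 : Polynomial.X ^ i % P = 0
    · exact Or.inr h0
    · exact Or.inl ((Polynomial.natDegree_lt_iff_degree_lt h0).2 h2)
  rcases h3 with h3 | h3
  · rw [h1, Polynomial.aeval_eq_sum_range' h3, LinearMap.sum_apply, map_sum]
    exact Finset.sum_eq_zero fun j hj => by
      rw [LinearMap.smul_apply, map_smul, hξ j (Finset.mem_range.1 hj), smul_zero]
  · rw [h1, h3]; simp

end Observability

/-! ### The coadjoint action and the normal form -/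

/-- The adjoint action of `G_{n,p}(𝕜)` on its Lie algebra. -/
def Ad (g : G 𝕜 k p) : E 𝕜 k p →ₗ[𝕜] E 𝕜 k p where
  toFun a := pair (g.T.val * fstM a - g.T.val * sndM a * g.T⁻¹.val * g.X)
    (g.T.val * sndM a * g.T⁻¹.val)
  map_add' a b := by
    refine ext_fstM_sndM ?_ ?_ <;> simp [Matrix.mul_add, Matrix.add_mul]
    abel
  map_smul' c a := by
    refine ext_fstM_sndM ?_ ?_ <;> simp [smul_sub]

@[simp] lemma fstM_Ad (g : G 𝕜 k p) (a : E 𝕜 k p) :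
    fstM (Ad g a) = g.T.val * fstM a - g.T.val * sndM a * g.T⁻¹.val * g.X := rfl
@[simp] lemma sndM_Ad (g : G 𝕜 k p) (a : E 𝕜 k p) :
    sndM (Ad g a) = g.T.val * sndM a * g.T⁻¹.val := rfl

/-- In terms of pairs, the coadjoint action by `(X, T)` is a change of basis by `T` combined with
the output injection `N' ↦ N' - X H'`; cyclicity of the trace is all that is used. -/
lemma linForm_Ad {H H' : Matrix (Fin p) (Fin k × Fin p) 𝕜}
    {N N' : Matrix (Fin k × Fin p) (Fin k × Fin p) 𝕜} {g : G 𝕜 k p} (h1 : H' * g.T.val = H)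
    (h2 : g.T.val * N = (N' - g.X * H') * g.T.val) (a : E 𝕜 k p) :
    linForm H' N' (Ad g a) = linForm H N a := by
  have e1 : N = g.T⁻¹.val * ((N' - g.X * H') * g.T.val) := by
    rw [← h2, ← Matrix.mul_assoc, Units.inv_mul, Matrix.one_mul]
  change ((g.T.val * fstM a - g.T.val * sndM a * g.T⁻¹.val * g.X) * H').trace +
    (N' * (g.T.val * sndM a * g.T⁻¹.val)).trace = (fstM a * H).trace + (N * sndM a).trace
  rw [← h1, e1, Matrix.sub_mul, Matrix.sub_mul, Matrix.mul_sub, Matrix.sub_mul, Matrix.trace_sub,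
    Matrix.trace_sub, ← Matrix.mul_assoc (fstM a), Matrix.trace_mul_comm (fstM a * H') g.T.val,
    Matrix.trace_mul_comm N']
  have e2 : (g.T.val * sndM a * g.T⁻¹.val * N').trace =
      (g.T⁻¹.val * (N' * g.T.val) * sndM a).trace := by
    rw [Matrix.mul_assoc, Matrix.mul_assoc, Matrix.trace_mul_comm, Matrix.mul_assoc,
      Matrix.trace_mul_comm (sndM a)]
    simp only [Matrix.mul_assoc]
  have e3 : (g.T.val * sndM a * g.T⁻¹.val * g.X * H').trace =
      (g.T⁻¹.val * (g.X * H' * g.T.val) * sndM a).trace := by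
    rw [Matrix.mul_assoc, Matrix.mul_assoc, Matrix.mul_assoc, Matrix.trace_mul_comm,
      Matrix.mul_assoc, Matrix.trace_mul_comm (sndM a)]
    simp only [Matrix.mul_assoc]
  rw [e2, e3, Matrix.mul_assoc g.T.val]
  ring

/-- Every symplectic linear form is in the coadjoint orbit of `α₀`. -/
lemma exists_α₀_Ad_eq (hk : 1 ≤ k) (hp : 1 ≤ p) {α : E 𝕜 k p →ₗ[𝕜] 𝕜}
    (hα : IsLeftInvariantSymplectic (dLeftForm α)) :
    ∃ g : G 𝕜 k p, ∀ a, α₀ 𝕜 k p (Ad g a) = α a := by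
  obtain ⟨H, N, rfl⟩ := exists_eq_linForm α
  have : Nonempty (Fin p) := ⟨⟨0, hp⟩⟩
  have : Nonempty (Fin k) := ⟨⟨0, hk⟩⟩
  have hrad : TrivialRadical (Matrix.toLin' H) (Matrix.toLin' N) := by
    intro u x hu hx
    have h0 : pair (LinearMap.toMatrix' x) (LinearMap.toMatrix' u) = 0 := by
      refine eq_zero_of_isLeftInvariantSymplectic hα
        ((linForm_bracketE_eq_zero_iff H N _).2 ⟨?_, ?_⟩)
      · have := congrArg LinearMap.toMatrix' hu
        simpa [LinearMap.toMatrix'_comp] using this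
      · have := congrArg LinearMap.toMatrix' hx
        simpa [LinearMap.toMatrix'_comp] using this
    have h1 := congrArg fstM h0
    have h2 := congrArg sndM h0
    simp only [fstM_pair, sndM_pair, fstM_zero, sndM_zero] at h1 h2
    exact ⟨by simpa using h2, by simpa using h1⟩
  have hobs : ∀ v, (∀ i < k, (H * N ^ i) *ᵥ v = 0) → v = 0 := fun v hv =>
    hrad.eq_zero (k := k) (by simp) fun i hi => by
      have := hv i hi
      rw [← Matrix.mulVec_mulVec] at this
      rwa [← Matrix.toLin'_pow, Matrix.toLin'_apply, Matrix.toLin'_apply]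
  -- The observability map is injective, so `H N ^ k` factors through it: a matrix analogue of a
  -- characteristic polynomial with coefficients `Z j`.
  obtain ⟨Z, hZ⟩ : ∃ Z : ℕ → Matrix (Fin p) (Fin p) 𝕜,
      H * N ^ k + ∑ j ∈ Finset.range k, Z j * (H * N ^ j) = 0 := by
    let O : (Fin k × Fin p → 𝕜) →ₗ[𝕜] (Fin k → Fin p → 𝕜) :=
      LinearMap.pi fun i => Matrix.toLin' (H * N ^ i.val)
    obtain ⟨x, hx⟩ := exists_comp_eq_of_ker_le O (Matrix.toLin' (H * N ^ k)) fun v hv => by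
      have : v = 0 := hobs v fun i hi =>
        (Matrix.toLin'_apply _ _).symm.trans (congrFun (LinearMap.mem_ker.1 hv) ⟨i, hi⟩)
      simp [this]
    refine ⟨fun j => if hj : j < k then
      -LinearMap.toMatrix' (x ∘ₗ LinearMap.single 𝕜 (fun _ => Fin p → 𝕜) ⟨j, hj⟩) else 0, ?_⟩
    apply Matrix.toLin'.injective
    rw [map_add, map_zero, ← hx, map_sum, Finset.sum_range]
    refine LinearMap.ext fun v => ?_
    simp only [LinearMap.add_apply, LinearMap.comp_apply, LinearMap.sum_apply]
    have h1 := LinearMap.sum_single_apply (fun _ : Fin k => Fin p → 𝕜) (O v)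
    conv_lhs => rw [← h1]
    rw [map_sum, ← Finset.sum_add_distrib]
    refine Finset.sum_eq_zero fun i _ => ?_
    simp [O, Matrix.toLin'_mul]
  -- Horner polynomials of that relation: `R 0 = H`, `R k = 0`, and `R (m + 1) = R m N + Z (k - 1 -
  -- m) H`.
  let R : ℕ → Matrix (Fin p) (Fin k × Fin p) 𝕜 := fun m =>
    H * N ^ m + ∑ j ∈ Finset.range m, Z (k - m + j) * (H * N ^ j)
  have hR0 : R 0 = H := by simp [R]
  have hRk : R k = 0 := by simpa [R] using hZ
  have hRsucc : ∀ m < k, R (m + 1) = R m * N + Z (k - (m + 1)) * H := fun m hm => by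
    simp only [R]
    rw [Finset.sum_range_succ', Matrix.add_mul, Matrix.sum_mul, pow_succ, Matrix.mul_assoc,
      add_assoc]
    congr 2
    · refine Finset.sum_congr rfl fun j _ => ?_
      rw [show k - (m + 1) + (j + 1) = k - m + j by omega, pow_succ]
      simp only [Matrix.mul_assoc]
    · simp
  -- The block rows of `T` are `R (k - 1), …, R 0`, in decreasing order because `H₀` selects the
  -- last one, which must be `H`. Since `R m` is `H N ^ m` plus lower terms, `T v = 0` yields
  -- inductively `H N ^ m v = 0` for all `m < k`, so `T` is invertible.
  let T : Matrix (Fin k × Fin p) (Fin k × Fin p) 𝕜 := Matrix.of fun a b => R (k - 1 - a.1) a.2 b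
  have hT : T.det ≠ 0 := by
    intro hdet
    obtain ⟨v, hv0, hv⟩ := Matrix.exists_mulVec_eq_zero_iff.2 hdet
    have hRv : ∀ m < k, R m *ᵥ v = 0 := fun m hm => by
      funext i
      have := congrFun hv (⟨k - 1 - m, by omega⟩, i)
      simp only [Matrix.mulVec, T, Matrix.of_apply, dotProduct] at this
      rw [show k - 1 - (k - 1 - m) = m by omega] at this
      exact this
    refine hv0 (hobs v fun i => ?_)
    induction i using Nat.strong_induction_on with
    | _ i ih =>
      intro hi
      have := hRv i hi
      simp only [R, Matrix.add_mulVec, Matrix.sum_mulVec] at this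
      rwa [Finset.sum_eq_zero, add_zero] at this
      intro j hj
      have hj' := Finset.mem_range.1 hj
      rw [← Matrix.mulVec_mulVec, ih j hj' (hj'.trans hi), Matrix.mulVec_zero]
  have hH : H₀ 𝕜 k p * T = H := by
    ext i b
    rw [H₀_mul_apply T (l := ⟨k - 1, by omega⟩) (by simp only; omega)]
    simp [T, hR0]
  -- With `X` the column of blocks `Z a`, block row `a` of the remaining identity is `R (k - 1 - a)
  -- N + Z a H = R (k - a)`. The right side is block row `a - 1` of `T`, as `N₀` requires, and is `R
  -- k = 0` for `a = 0`.
  refine ⟨⟨Matrix.of fun a j => Z a.1 a.2 j, Matrix.GeneralLinearGroup.mkOfDetNeZero T hT⟩,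
    linForm_Ad hH ?_⟩
  change T * N = (N₀ 𝕜 k p - _) * T
  rw [Matrix.sub_mul, Matrix.mul_assoc, hH, eq_sub_iff_add_eq]
  ext ⟨a, i⟩ b
  have e1 : (T * N) (a, i) b = (R (k - 1 - a) * N) i b := rfl
  have e2 : ((Matrix.of fun (a : Fin k × Fin p) j => Z a.1 a.2 j) * H) (a, i) b =
    (Z a * H) i b := rfl
  have e3 := hRsucc (k - 1 - a) (by omega)
  rw [show k - (k - 1 - a.val + 1) = a by omega] at e3
  rw [Matrix.add_apply, e1, e2, ← Matrix.add_apply, ← e3]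
  rcases Nat.eq_zero_or_pos a.val with h0 | h0
  · rw [N₀_mul_apply_zero _ h0, show k - 1 - a.val + 1 = k by omega, hRk, Matrix.zero_apply]
  · rw [N₀_mul_apply_succ T (a := ⟨a.val - 1, by omega⟩) (by simp only; omega)]
    simp only [T, Matrix.of_apply]
    congr 2
    omega

/-! ### The exponential map in the chart -/

lemma completeSpace_of_finiteDimensional (K A : Type*) [RCLike K] [NormedRing A]
    [NormedAlgebra K A] [FiniteDimensional K A] : CompleteSpace A :=
  FiniteDimensional.complete K A

/-- Without its constant term the exponential series involves only products of copies of `x`, so a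
closed subspace stable under products contains its sum. -/
lemma exp_sub_one_mem {A : Type*} [NormedRing A] [NormedAlgebra 𝕜 A] [CompleteSpace A]
    {S : Submodule 𝕜 A} (hS : IsClosed (S : Set A)) (hmul : ∀ x ∈ S, ∀ y ∈ S, x * y ∈ S) {x : A}
    (hx : x ∈ S) : NormedSpace.exp x - 1 ∈ S := by
  have h := NormedSpace.exp_series_hasSum_exp' (𝕂 := 𝕜) x
  rw [← hasSum_nat_add_iff' 1] at h
  simp only [Finset.range_one, Finset.sum_singleton, Nat.factorial_zero, Nat.cast_one, inv_one,
    pow_zero, one_smul] at h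
  have hpow : ∀ n : ℕ, x ^ (n + 1) ∈ S := fun n => by
    induction n with
    | zero => simpa using hx
    | succ n ih => rw [pow_succ]; exact hmul _ ih _ hx
  exact hS.mem_of_tendsto h (Filter.Eventually.of_forall fun s =>
    S.sum_mem fun n _ => S.smul_mem _ (hpow n))

/-- `algEmb` as a linear map. -/
def algEmbLin : E 𝕜 k p →ₗ[𝕜] Matrix ((Fin k × Fin p) ⊕ Fin p) ((Fin k × Fin p) ⊕ Fin p) 𝕜 where
  toFun := algEmb
  map_add' a b := by simp [algEmb, Matrix.fromBlocks_add]
  map_smul' c a := by simp [algEmb, Matrix.fromBlocks_smul]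

/-- The left inverse of `algEmb` given by the upper blocks. -/
def algProj : Matrix ((Fin k × Fin p) ⊕ Fin p) ((Fin k × Fin p) ⊕ Fin p) 𝕜 →ₗ[𝕜] E 𝕜 k p where
  toFun A := pair A.toBlocks₁₂ A.toBlocks₁₁
  map_add' a b := rfl
  map_smul' c a := rfl

lemma algProj_algEmb (a : E 𝕜 k p) : algProj (algEmb a) = a := rfl

lemma algEmb_injective : Function.Injective (algEmb : E 𝕜 k p → _) :=
  Function.LeftInverse.injective algProj_algEmb

lemma algEmb_mulE (a b : E 𝕜 k p) : algEmb (mulE a b) = algEmb a * algEmb b := by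
  simp [algEmb, Matrix.fromBlocks_multiply]

lemma grpEmb_eq (g : G 𝕜 k p) : grpEmb g = 1 + algEmb (g.toE - (1 : G 𝕜 k p).toE) := by
  rw [grpEmb, algEmb, ← Matrix.fromBlocks_one, Matrix.fromBlocks_add]
  simp

/-- The exponential of the Lie algebra minus the neutral element, in the vector space `E`. -/
def expE (a : E 𝕜 k p) : E 𝕜 k p := algProj (NormedSpace.exp (algEmb a) - 1)

section

open scoped Matrix.Norms.Operator

lemma exp_algEmb_sub_one_mem {h : Submodule 𝕜 (E 𝕜 k p)}
    (hm : ∀ a ∈ h, ∀ b ∈ h, mulE a b ∈ h) {a : E 𝕜 k p} (ha : a ∈ h) :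
    NormedSpace.exp (algEmb a) - 1 ∈ h.map algEmbLin := by
  have := completeSpace_of_finiteDimensional 𝕜
    (Matrix ((Fin k × Fin p) ⊕ Fin p) ((Fin k × Fin p) ⊕ Fin p) 𝕜)
  refine exp_sub_one_mem (𝕜 := 𝕜) (Submodule.closed_of_finiteDimensional _) ?_
    (Submodule.mem_map_of_mem ha)
  rintro _ ⟨a, ha, rfl⟩ _ ⟨b, hb, rfl⟩
  exact ⟨mulE a b, hm a ha b hb, algEmb_mulE a b⟩

lemma expE_mem {h : Submodule 𝕜 (E 𝕜 k p)} (hm : ∀ a ∈ h, ∀ b ∈ h, mulE a b ∈ h) {a : E 𝕜 k p}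
    (ha : a ∈ h) : expE a ∈ h := by
  obtain ⟨b, hb, hab⟩ := exp_algEmb_sub_one_mem hm ha
  rw [expE, ← hab]
  exact hb

lemma exp_algEmb (a : E 𝕜 k p) : NormedSpace.exp (algEmb a) = 1 + algEmb (expE a) := by
  obtain ⟨b, hb, hab⟩ := exp_algEmb_sub_one_mem (h := ⊤) (fun _ _ _ _ => Submodule.mem_top)
    (Submodule.mem_top (x := a))
  rw [expE, ← hab]
  exact (eq_add_of_sub_eq' hab.symm)

lemma expE_add_expE_neg (a : E 𝕜 k p) : expE a + expE (-a) + mulE (expE a) (expE (-a)) = 0 := by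
  apply algEmb_injective
  have h1 : NormedSpace.exp (algEmb a) * NormedSpace.exp (algEmb (-a)) = 1 := by
    have : algEmb (-a) = -algEmb a := map_neg algEmbLin a
    rw [this, Matrix.exp_neg]
    exact Matrix.mul_nonsing_inv _ ((Matrix.isUnit_iff_isUnit_det _).1 (Matrix.isUnit_exp _))
  have h2 : ∀ a b : E 𝕜 k p, algEmb (a + b) = algEmb a + algEmb b := map_add algEmbLin
  have h3 : algEmb (0 : E 𝕜 k p) = 0 := map_zero algEmbLin
  rw [exp_algEmb, exp_algEmb, add_mul, one_mul, mul_add, mul_one, ← algEmb_mulE] at h1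
  rw [h2, h2, h3]
  have := sub_eq_zero.2 h1
  rw [← this]
  abel

/-- The strict derivative is what the inverse function theorem uses in `eventually_exists_expE_eq`.
-/
lemma hasStrictFDerivAt_expE :
    HasStrictFDerivAt (expE : E 𝕜 k p → E 𝕜 k p) (ContinuousLinearMap.id 𝕜 (E 𝕜 k p)) 0 := by
  have := completeSpace_of_finiteDimensional 𝕜
    (Matrix ((Fin k × Fin p) ⊕ Fin p) ((Fin k × Fin p) ⊕ Fin p) 𝕜)
  have h1 : HasStrictFDerivAt
    (LinearMap.toContinuousLinearMap (algEmbLin (𝕜 := 𝕜) (k := k) (p := p)))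
    (LinearMap.toContinuousLinearMap (algEmbLin (𝕜 := 𝕜) (k := k) (p := p))) 0 :=
    ContinuousLinearMap.hasStrictFDerivAt _
  have h2 := hasStrictFDerivAt_exp_zero (𝕂 := 𝕜)
    (𝔸 := Matrix ((Fin k × Fin p) ⊕ Fin p) ((Fin k × Fin p) ⊕ Fin p) 𝕜)
  rw [← map_zero (LinearMap.toContinuousLinearMap (algEmbLin (𝕜 := 𝕜) (k := k) (p := p)))] at h2
  have h3 := (LinearMap.toContinuousLinearMap (algProj (𝕜 := 𝕜) (k := k) (p := p))
    ).hasStrictFDerivAt.comp (0 : E 𝕜 k p) ((h2.comp _ h1).sub_const 1)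
  exact h3

lemma hasDerivAt_expE (a : E 𝕜 k p) (t : ℝ) :
    HasDerivAt (fun t : ℝ => expE (t • a)) (a + mulE (expE (t • a)) a) t := by
  have := completeSpace_of_finiteDimensional 𝕜
    (Matrix ((Fin k × Fin p) ⊕ Fin p) ((Fin k × Fin p) ⊕ Fin p) 𝕜)
  have h1 := (hasDerivAt_exp_smul_const (algEmb a) t).sub_const 1
  have h2 := ((LinearMap.toContinuousLinearMap (algProj (𝕜 := 𝕜) (k := k) (p := p))
    ).restrictScalars ℝ).hasFDerivAt.comp_hasDerivAt t h1
  have h3 : ∀ t : ℝ, t • algEmb a = algEmb (t • a) := fun t => by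
    rw [algEmb, Matrix.fromBlocks_smul, smul_zero, smul_zero]
    rfl
  have h4 : NormedSpace.exp (t • algEmb a) * algEmb a = algEmb (a + mulE (expE (t • a)) a) := by
    rw [h3, exp_algEmb, add_mul, one_mul, ← algEmb_mulE]
    exact (map_add algEmbLin _ _).symm
  have h5 : (fun t : ℝ => expE (t • a)) =
      fun t : ℝ => algProj (NormedSpace.exp (t • algEmb a) - 1) :=
    funext fun t => by rw [h3, expE]
  rw [h5]
  exact h2.congr_deriv (congrArg algProj h4)

end

lemma expE_zero : expE (0 : E 𝕜 k p) = 0 := by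
  have h : algEmb (0 : E 𝕜 k p) = 0 := map_zero algEmbLin
  rw [expE, h, NormedSpace.exp_zero, sub_self, map_zero]

lemma contDiff_expE_smul (a : E 𝕜 k p) : ContDiff ℝ 1 fun t : ℝ => expE (t • a) := by
  rw [contDiff_one_iff_deriv]
  have hd : Differentiable ℝ fun t : ℝ => expE (t • a) :=
    fun t => (hasDerivAt_expE a t).differentiableAt
  refine ⟨hd, ?_⟩
  rw [funext fun t => (hasDerivAt_expE a t).deriv]
  exact continuous_const.add (((mulCLM 𝕜 k p).flip a).continuous.comp hd.continuous)

/-- The exponential map of `G_{n,p}(𝕜)`. -/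
def expG (a : E 𝕜 k p) : G 𝕜 k p where
  X := fstM (expE a)
  T :=
    { val := 1 + sndM (expE a)
      inv := 1 + sndM (expE (-a))
      val_inv := by
        have := congrArg sndM (expE_add_expE_neg a)
        simp only [sndM_add, sndM_mulE, sndM_zero] at this
        rw [add_mul, one_mul, mul_add, mul_one, add_assoc, ← add_assoc (sndM (expE (-a))),
          add_comm (sndM (expE (-a))), this, add_zero]
      inv_val := by
        have := congrArg sndM (expE_add_expE_neg (-a))
        simp only [sndM_add, sndM_mulE, sndM_zero, neg_neg] at this
        rw [add_mul, one_mul, mul_add, mul_one, add_assoc, ← add_assoc (sndM (expE a)),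
          add_comm (sndM (expE a)), this, add_zero] }

lemma toE_expG (a : E 𝕜 k p) : (expG a).toE = (1 : G 𝕜 k p).toE + expE a :=
  ext_fstM_sndM (by simp [expG]) (by simp [expG])

lemma grpEmb_injective : Function.Injective (grpEmb : G 𝕜 k p → _) := fun g h hgh => by
  rw [grpEmb_eq, grpEmb_eq] at hgh
  exact G.toE_injective (sub_left_injective (algEmb_injective (add_right_injective _ hgh)))

lemma isExp_expG (a : E 𝕜 k p) : IsExp a (expG a) := by
  rw [IsExp, grpEmb_eq, toE_expG, add_sub_cancel_left, exp_algEmb]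

lemma isExp_iff {a : E 𝕜 k p} {g : G 𝕜 k p} : IsExp a g ↔ g = expG a := by
  refine ⟨fun h => grpEmb_injective (h.trans (isExp_expG a).symm), ?_⟩
  rintro rfl
  exact isExp_expG a

/-! ### Closed subgroups attached to product-closed subspaces -/

section Subalgebra

variable {h : Submodule 𝕜 (E 𝕜 k p)} (hm : ∀ a ∈ h, ∀ b ∈ h, mulE a b ∈ h)

include hm in
-- Since `g b = b + (g - 1) b`, left multiplication by `g` maps `h` into itself; being injective, it
-- is onto by dimension.
lemma map_dL_eq {g : G 𝕜 k p} (hg : g.toE - (1 : G 𝕜 k p).toE ∈ h) :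
    h.map (dL g.T.val) = h := by
  have hinj : Function.Injective (dL (k := k) (p := p) g.T.val) :=
    Function.LeftInverse.injective (dL_inv_dL (det_sndM_toE_ne_zero g))
  refine Submodule.eq_of_le_of_finrank_eq ?_
    (LinearEquiv.finrank_eq (Submodule.equivMapOfInjective _ hinj h)).symm
  rintro _ ⟨b, hb, rfl⟩
  have : dL g.T.val b = b + mulE (g.toE - (1 : G 𝕜 k p).toE) b := by
    rw [sub_mulE, mulE_toE_one, add_sub_cancel]; rfl
  rw [this]
  exact h.add_mem hb (hm _ hg b hb)

/-- The group `(1 + 𝔥) ∩ G_{n,p}(𝕜)` of a subspace `𝔥` that is closed under the product. -/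
def translateGroup : Subgroup (G 𝕜 k p) where
  carrier := {g | g.toE - (1 : G 𝕜 k p).toE ∈ h}
  one_mem' := by simp
  mul_mem' {a b} ha hb := by
    change (a * b).toE - _ ∈ h
    rw [toE_mul, add_sub_right_comm]
    refine h.add_mem ha ?_
    rw [← map_dL_eq hm ha]
    exact Submodule.mem_map_of_mem hb
  inv_mem' {a} ha := by
    have h1 := toE_mul a a⁻¹
    rw [mul_inv_cancel] at h1
    -- `a (a⁻¹ - 1) = 1 - a` lies in `h`, and left multiplication by `a` permutes `h`, so `a⁻¹ - 1`
    -- lies in `h`.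
    have h2 : mulE a.toE ((a⁻¹).toE - (1 : G 𝕜 k p).toE) ∈ h := by
      rw [eq_sub_of_add_eq' h1.symm, ← neg_sub]
      exact h.neg_mem ha
    rw [← map_dL_eq hm ha] at h2
    obtain ⟨b, hb, hab⟩ := h2
    have hinj : Function.Injective (dL (k := k) (p := p) a.T.val) :=
      Function.LeftInverse.injective (dL_inv_dL (det_sndM_toE_ne_zero a))
    change (a⁻¹).toE - _ ∈ h
    rwa [← hinj hab]

lemma mem_translateGroup {g : G 𝕜 k p} :
    g ∈ translateGroup hm ↔ g.toE - (1 : G 𝕜 k p).toE ∈ h := Iff.rfl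

lemma expG_mem_connSubgroup {h : Submodule 𝕜 (E 𝕜 k p)} {a : E 𝕜 k p} (ha : a ∈ h) :
    expG a ∈ connSubgroup h := Subgroup.subset_closure ⟨a, ha, isExp_expG a⟩

lemma connSubgroup_le_translateGroup : connSubgroup h ≤ translateGroup hm := by
  rw [connSubgroup, Subgroup.closure_le]
  rintro g ⟨a, ha, hg⟩
  rw [isExp_iff] at hg
  rw [hg, SetLike.mem_coe, mem_translateGroup, toE_expG, add_sub_cancel_left]
  exact expE_mem hm ha

include hm in
-- `expE` restricts to a map `h → h` with derivative the identity at `0`, so its range is a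
-- neighbourhood of `0` in `h`. The projection `P` only serves to give the restriction its codomain.
lemma eventually_exists_expE_eq : ∀ᶠ b in 𝓝 (0 : E 𝕜 k p), b ∈ h → ∃ a ∈ h, expE a = b := by
  obtain ⟨P, hP⟩ := h.subtype.exists_leftInverse_of_injective h.ker_subtype
  have hP' : ∀ x : h, P x = x := LinearMap.congr_fun hP
  let f : h → h := fun a => P (expE (a : E 𝕜 k p))
  have hf : HasStrictFDerivAt f
      ((ContinuousLinearEquiv.refl 𝕜 h : h ≃L[𝕜] h) : h →L[𝕜] h) 0 := by
    have h1 := (LinearMap.toContinuousLinearMap P).hasStrictFDerivAt.comp (0 : h)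
      ((hasStrictFDerivAt_expE (𝕜 := 𝕜) (k := k) (p := p)).comp (0 : h)
        h.subtypeL.hasStrictFDerivAt)
    exact h1.congr_fderiv (ContinuousLinearMap.ext hP')
  have h2 := hf.map_nhds_eq_of_equiv
  have hf0 : f 0 = 0 := by simp [f, expE_zero]
  rw [hf0] at h2
  have h3 : Set.range f ∈ 𝓝 (0 : h) := by
    rw [← h2]
    exact Filter.mem_map.2 (Filter.mem_of_superset Filter.univ_mem fun x _ => ⟨x, rfl⟩)
  obtain ⟨u, hu, huf⟩ := (mem_nhds_subtype _ _ _).1 h3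
  filter_upwards [hu] with b hb hbh
  obtain ⟨a, ha⟩ := huf (show (⟨b, hbh⟩ : h) ∈ Subtype.val ⁻¹' u from hb)
  refine ⟨a, a.2, ?_⟩
  have h4 : P (expE (a : E 𝕜 k p)) = ⟨expE (a : E 𝕜 k p), expE_mem hm a.2⟩ :=
    hP' ⟨expE (a : E 𝕜 k p), expE_mem hm a.2⟩
  exact congrArg Subtype.val (h4.symm.trans ha)

lemma continuous_toE : Continuous (G.toE : G 𝕜 k p → E 𝕜 k p) :=
  G.isOpenEmbedding_toE.continuous

lemma eventually_mem_connSubgroup :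
    ∀ᶠ g in 𝓝 (1 : G 𝕜 k p), g ∈ translateGroup hm → g ∈ connSubgroup h := by
  have hc : Filter.Tendsto (fun g : G 𝕜 k p => g.toE - (1 : G 𝕜 k p).toE) (𝓝 1) (𝓝 0) := by
    have := (continuous_toE.sub continuous_const).tendsto' (1 : G 𝕜 k p)
      (0 : E 𝕜 k p) (sub_self (1 : G 𝕜 k p).toE)
    exact this
  filter_upwards [hc.eventually (eventually_exists_expE_eq hm)] with g hg hgh
  obtain ⟨a, ha, hag⟩ := hg hgh
  have : g = expG a := G.toE_injective (by rw [toE_expG, hag, add_sub_cancel])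
  rw [this]
  exact expG_mem_connSubgroup ha

instance : IsTopologicalGroup (G 𝕜 k p) :=
  topologicalGroup_of_lieGroup 𝓘(𝕜, E 𝕜 k p) ∞

lemma isClosed_translateGroup : IsClosed (translateGroup hm : Set (G 𝕜 k p)) :=
  (Submodule.closed_of_finiteDimensional h).preimage (continuous_toE.sub continuous_const)

/-- In the group `translateGroup`, the cosets of the subgroup `connSubgroup` are open. -/
lemma eventually_inv_mul_mem_connSubgroup (g : G 𝕜 k p) :
    ∀ᶠ m in 𝓝 g, g⁻¹ * m ∈ translateGroup hm → g⁻¹ * m ∈ connSubgroup h := by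
  have hc : Filter.Tendsto (fun m : G 𝕜 k p => g⁻¹ * m) (𝓝 g) (𝓝 1) := by
    have := (continuous_const_mul g⁻¹).tendsto g
    rwa [inv_mul_cancel] at this
  exact hc.eventually (eventually_mem_connSubgroup hm)

include hm in
-- An open subgroup of a topological group is closed; here the ambient group is `translateGroup`,
-- itself closed in `G` because it is cut out by linear equations. The two may differ, since
-- `translateGroup` need not be connected.
lemma isClosed_connSubgroup : IsClosed (connSubgroup h : Set (G 𝕜 k p)) := by
  refine isClosed_of_closure_subset fun g hg => ?_
  have hle : (connSubgroup h : Set (G 𝕜 k p)) ⊆ translateGroup hm :=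
    connSubgroup_le_translateGroup hm
  have hgt : g ∈ translateGroup hm := (isClosed_translateGroup hm).closure_subset_iff.2 hle hg
  obtain ⟨m, hm1, hm2⟩ := mem_closure_iff_nhds.1 hg _ (eventually_inv_mul_mem_connSubgroup hm g)
  have h3 := hm1 ((translateGroup hm).mul_mem ((translateGroup hm).inv_mem hgt) (hle hm2))
  have h4 := (connSubgroup h).mul_mem hm2 ((connSubgroup h).inv_mem h3)
  simpa using h4

include hm in
-- A one-parameter subgroup contained in `1 + h` has its velocity at `0` in the closed subspace `h`.
lemma lieAlgebraOf_connSubgroup : lieAlgebraOf (connSubgroup h) = (h : Set (E 𝕜 k p)) := by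
  ext a
  constructor
  · intro ha
    have h1 : ∀ t : ℝ, expE (t • a) ∈ h := fun t => by
      obtain ⟨g, hg, hga⟩ := ha t
      have := connSubgroup_le_translateGroup hm hg
      rw [isExp_iff.1 hga, mem_translateGroup, toE_expG, add_sub_cancel_left] at this
      exact this
    have h2 := (hasDerivAt_expE a 0).tendsto_slope_zero
    simp only [zero_add, zero_smul, expE_zero, sub_zero, zero_mulE, add_zero] at h2
    refine (Submodule.closed_of_finiteDimensional h).mem_of_tendsto h2
      (Filter.Eventually.of_forall fun t => ?_)
    rw [RCLike.real_smul_eq_coe_smul (K := 𝕜)]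
    exact h.smul_mem _ (h1 t)
  · intro ha t
    refine ⟨expG (t • a), expG_mem_connSubgroup ?_, isExp_expG _⟩
    rw [RCLike.real_smul_eq_coe_smul (K := 𝕜)]
    exact h.smul_mem _ ha

end Subalgebra

/-! ### Smooth charts adapted to a subspace -/

/-- The inverse function theorem, in a form that provides a smooth chart inside an open set. -/
lemma exists_chart_of_hasFDerivAt {V W : Type*} [NormedAddCommGroup V] [NormedSpace 𝕜 V]
    [CompleteSpace V] [NormedAddCommGroup W] [NormedSpace 𝕜 W] {f : V → W} (hf : ContDiff 𝕜 ∞ f)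
    {x : V} {A : V ≃L[𝕜] W} (hA : HasFDerivAt f (A : V →L[𝕜] W) x) {O : Set W} (hO : IsOpen O)
    (hx : f x ∈ O) :
    ∃ φ : OpenPartialHomeomorph W V, f x ∈ φ.source ∧ φ.source ⊆ O ∧
      ContDiffOn 𝕜 ∞ φ φ.source ∧ ContDiffOn 𝕜 ∞ φ.symm φ.target ∧
      ∀ y ∈ φ.source, f (φ y) = y ∧ ∃ B : V ≃L[𝕜] W,
        HasFDerivAt f (B : V →L[𝕜] W) (φ y) ∧ HasFDerivAt φ (B.symm : W →L[𝕜] V) y := by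
  have hx1 := hf.contDiffAt.mem_toOpenPartialHomeomorph_source hA (n := ∞) (by simp)
  let φ₀ := hf.contDiffAt.toOpenPartialHomeomorph f hA (n := ∞) (by simp)
  have hφ₀ : (φ₀ : V → W) = f := rfl
  -- Shrinking to points where the derivative is invertible makes the inverse smooth on the whole
  -- target, not only at one point.
  let U : Set V := f ⁻¹' O ∩ fderiv 𝕜 f ⁻¹' Set.range ((↑) : (V ≃L[𝕜] W) → V →L[𝕜] W)
  have hU : IsOpen U := (hO.preimage hf.continuous).inter
    (ContinuousLinearEquiv.isOpen.preimage (hf.continuous_fderiv (by simp)))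
  let φ := φ₀.restrOpen U hU
  have hsource : φ.source = φ₀.source ∩ U := rfl
  have hφ : (φ : V → W) = f := rfl
  have hB : ∀ y ∈ φ.target, ∃ B : V ≃L[𝕜] W, HasFDerivAt f (B : V →L[𝕜] W) (φ.symm y) :=
      fun y hy => by
    have h1 := φ.map_target hy
    rw [hsource] at h1
    obtain ⟨B, hB⟩ := h1.2.2
    refine ⟨B, ?_⟩
    rw [hB]
    exact (hf.differentiable (by simp) _).hasFDerivAt
  refine ⟨φ.symm, ?_, ?_, ?_, ?_, ?_⟩
  · exact φ.map_source (x := x) ⟨hx1, hx, ⟨A, hA.fderiv.symm⟩⟩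
  · intro y hy
    have h1 := φ.map_target hy
    have h2 : f (φ.symm y) = y := φ.right_inv hy
    rw [hsource] at h1
    have h3 : f (φ.symm y) ∈ O := h1.2.1
    rwa [h2] at h3
  · intro y hy
    obtain ⟨B, hB⟩ := hB y hy
    exact (φ.contDiffAt_symm hy hB hf.contDiffAt).contDiffWithinAt
  · rw [φ.symm_symm, hφ]
    exact hf.contDiffOn
  · intro y hy
    obtain ⟨B, hB⟩ := hB y hy
    exact ⟨φ.right_inv hy, B, hB, φ.hasFDerivAt_symm hy hB⟩

/-- The product coordinates near a point of the vector space `E`, given by two linear maps. -/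
def slideMap {V W : Type*} [NormedAddCommGroup V] [NormedSpace 𝕜 V] [NormedAddCommGroup W]
    [NormedSpace 𝕜 W] (e : E 𝕜 k p) (i : V →L[𝕜] E 𝕜 k p) (j : W →L[𝕜] E 𝕜 k p) (x : V × W) :
    E 𝕜 k p :=
  -- This is `e (1 + j x₂) (1 + i x₁)` in `gl(𝕜ⁿ⁺ᵖ)`: when `i` has range `𝔥`, fixing `x₂` leaves a
  -- piece of a left coset of `1 + 𝔥`.
  (e + mulCLM 𝕜 k p e (j x.2)) + mulCLM 𝕜 k p (e + mulCLM 𝕜 k p e (j x.2)) (i x.1)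

lemma hasFDerivAt_slideMap {V W : Type*} [NormedAddCommGroup V] [NormedSpace 𝕜 V]
    [NormedAddCommGroup W] [NormedSpace 𝕜 W] (e : E 𝕜 k p) (i : V →L[𝕜] E 𝕜 k p)
    (j : W →L[𝕜] E 𝕜 k p) (x : V × W) :
    ∃ A : V × W →L[𝕜] E 𝕜 k p, HasFDerivAt (slideMap e i j) A x ∧
      ∀ v, A v = mulE e (j v.2) + (mulE (e + mulE e (j x.2)) (i v.1) +
        mulE (mulE e (j v.2)) (i x.1)) := by
  have h1 : HasFDerivAt (fun x : V × W => e + mulCLM 𝕜 k p e (j x.2))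
      (mulCLM 𝕜 k p e ∘L j ∘L ContinuousLinearMap.snd 𝕜 V W) x :=
    (mulCLM 𝕜 k p e ∘L j ∘L ContinuousLinearMap.snd 𝕜 V W).hasFDerivAt.const_add e
  have h2 : HasFDerivAt (fun x : V × W => i x.1) (i ∘L ContinuousLinearMap.fst 𝕜 V W) x :=
    (i ∘L ContinuousLinearMap.fst 𝕜 V W).hasFDerivAt
  have h3 := (mulCLM 𝕜 k p).hasFDerivAt.comp x h1
  exact ⟨_, h1.add (h3.clm_apply h2), fun v => rfl⟩

lemma contDiff_slideMap {V W : Type*} [NormedAddCommGroup V] [NormedSpace 𝕜 V]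
    [NormedAddCommGroup W] [NormedSpace 𝕜 W] (e : E 𝕜 k p) (i : V →L[𝕜] E 𝕜 k p)
    (j : W →L[𝕜] E 𝕜 k p) : ContDiff 𝕜 ∞ (slideMap e i j) := by
  have h1 : ContDiff 𝕜 ∞ (fun x : V × W => e + mulCLM 𝕜 k p e (j x.2)) :=
    contDiff_const.add (mulCLM 𝕜 k p e ∘L j ∘L ContinuousLinearMap.snd 𝕜 V W).contDiff
  exact h1.add (((mulCLM 𝕜 k p).contDiff.comp h1).clm_apply
    (i ∘L ContinuousLinearMap.fst 𝕜 V W).contDiff)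

/-- The left translation of tangent vectors as a linear equivalence. -/
def dLEquiv (g : G 𝕜 k p) : E 𝕜 k p ≃ₗ[𝕜] E 𝕜 k p :=
  LinearEquiv.ofLinearMap (dL g.T.val) (dL (sndM g.toE)⁻¹)
    (LinearMap.ext fun v => dL_dL_inv (det_sndM_toE_ne_zero g) v)
    (LinearMap.ext fun v => dL_inv_dL (det_sndM_toE_ne_zero g) v)

/-! ### Left-invariant foliations and their leaves -/

section Foliation

variable {h : Submodule 𝕜 (E 𝕜 k p)} (hm : ∀ a ∈ h, ∀ b ∈ h, mulE a b ∈ h)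

/-- Linear coordinates of `E` that are adapted to a subspace. -/
lemma exists_adapted_coordinates (h : Submodule 𝕜 (E 𝕜 k p)) :
    ∃ (d c : ℕ) (i : (Fin d → 𝕜) →L[𝕜] E 𝕜 k p) (j : (Fin c → 𝕜) →L[𝕜] E 𝕜 k p)
      (A : ((Fin d → 𝕜) × (Fin c → 𝕜)) ≃L[𝕜] E 𝕜 k p),
      (∀ v, v ∈ h ↔ ∃ a, i a = v) ∧ ∀ x, A x = i x.1 + j x.2 := by
  obtain ⟨h', hc⟩ := h.exists_isCompl
  let i₀ := (Module.finBasis 𝕜 h).equivFun.symm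
  let j₀ := (Module.finBasis 𝕜 h').equivFun.symm
  refine ⟨_, _, LinearMap.toContinuousLinearMap (h.subtype ∘ₗ i₀.toLinearMap),
    LinearMap.toContinuousLinearMap (h'.subtype ∘ₗ j₀.toLinearMap),
    ((i₀.prodCongr j₀).trans (Submodule.prodEquivOfIsCompl h h' hc)).toContinuousLinearEquiv,
    fun v => ⟨fun hv => ⟨i₀.symm ⟨v, hv⟩, ?_⟩, ?_⟩, fun x => ?_⟩
  · exact congrArg Subtype.val (i₀.apply_symm_apply ⟨v, hv⟩)
  · rintro ⟨a, rfl⟩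
    exact (i₀ a).2
  · exact Submodule.coe_prodEquivOfIsCompl' h h' hc (i₀ x.1, j₀ x.2)

include hm in
-- Here `m = e (1 + b)`, and `1 + b` preserves `h` by `map_dL_eq`. So the tangent space is
-- translated by the same matrix all along a slice of `slideMap`.
lemma map_dL_eq_of_toE_eq {m : G 𝕜 k p} {e b : E 𝕜 k p} (hb : b ∈ h)
    (hme : m.toE = e + mulE e b) : h.map (dL m.T.val) = h.map (dL (sndM e)) := by
  have hmT : sndM m.toE = sndM e * (1 + sndM b) := by
    rw [hme, Matrix.mul_add, Matrix.mul_one]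
    rfl
  have hdet : (1 + sndM b).det ≠ 0 := by
    have := det_sndM_toE_ne_zero m
    rw [hmT, Matrix.det_mul] at this
    exact right_ne_zero_of_mul this
  obtain ⟨l, hl⟩ := exists_toE_eq (e := (1 : G 𝕜 k p).toE + b) (by simpa using hdet)
  have hlT : l.T.val = 1 + sndM b := by
    rw [← sndM_toE, hl]; rfl
  have hlh : h.map (dL l.T.val) = h := map_dL_eq hm (by rwa [hl, add_sub_cancel_left])
  have : dL (k := k) (p := p) m.T.val = dL (sndM e) ∘ₗ dL l.T.val := by
    refine LinearMap.ext fun v => ?_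
    rw [LinearMap.comp_apply, dL_dL, hlT, ← hmT, sndM_toE]
  rw [this, Submodule.map_comp, hlh]

lemma hasFDerivAt_slideMap_zero {V W : Type*} [NormedAddCommGroup V] [NormedSpace 𝕜 V]
    [NormedAddCommGroup W] [NormedSpace 𝕜 W] (g : G 𝕜 k p) {i : V →L[𝕜] E 𝕜 k p}
    {j : W →L[𝕜] E 𝕜 k p} {A : (V × W) ≃L[𝕜] E 𝕜 k p} (hA : ∀ x, A x = i x.1 + j x.2) :
    HasFDerivAt (slideMap g.toE i j)
      ((A.trans (dLEquiv g).toContinuousLinearEquiv : (V × W) ≃L[𝕜] E 𝕜 k p) :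
        V × W →L[𝕜] E 𝕜 k p) 0 := by
  obtain ⟨B, hB, hBA⟩ := hasFDerivAt_slideMap g.toE i j 0
  refine hB.congr_fderiv (ContinuousLinearMap.ext fun v => ?_)
  rw [hBA, Prod.fst_zero, Prod.snd_zero, map_zero, map_zero, mulE_zero, mulE_zero, add_zero,
    add_zero, add_comm, ← mulE_add, ← hA]
  rfl

/-- The left invariant foliation whose tangent space at the neutral element is a subspace that is
closed under the product. -/
def leftFoliation : Foliation 𝕜 k p where
  tangent g := h.map (dL g.T.val)
  exists_flat_chart g := by
    obtain ⟨d, c, i, j, A, hi, hA⟩ := exists_adapted_coordinates h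
    have h0 : slideMap g.toE i j 0 = g.toE := by simp [slideMap]
    obtain ⟨φ, h1, h2, h3, h4, h5⟩ := exists_chart_of_hasFDerivAt
      (contDiff_slideMap g.toE i j) (hasFDerivAt_slideMap_zero g hA)
      (G.isOpenEmbedding_toE (𝕜 := 𝕜) (k := k) (p := p)).isOpen_range
      (by rw [h0]; exact ⟨g, rfl⟩)
    rw [h0] at h1
    refine ⟨d, c, φ, h1, h2, h3, h4, fun m hms v => ?_⟩
    obtain ⟨h6, B, hB, hφ⟩ := h5 _ hms
    obtain ⟨B', hB', hBA⟩ := hasFDerivAt_slideMap g.toE i j (φ m.toE)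
    -- On vectors along the slice the derivative of `slideMap` is `i` followed by the translation,
    -- hence it sends the slice directions onto the tangent space.
    have hBB : ∀ v, v.2 = 0 → B v = dL (sndM (g.toE + mulE g.toE (j (φ m.toE).2))) (i v.1) :=
      fun v hv => by
        have : B v = B' v := DFunLike.congr_fun (hB.unique hB') v
        rw [this, hBA, hv, map_zero, mulE_zero, zero_mulE, add_zero, zero_add]
        rfl
    rw [map_dL_eq_of_toE_eq hm ((hi _).2 ⟨(φ m.toE).1, rfl⟩) h6.symm, hφ.fderiv]
    change _ ↔ (B.symm v).2 = 0
    constructor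
    · rintro ⟨b, hb, rfl⟩
      obtain ⟨b, rfl⟩ := (hi b).1 hb
      exact congrArg Prod.snd ((congrArg B.symm (hBB (b, 0) rfl)).symm.trans
        (B.symm_apply_apply (b, 0)))
    · intro hv
      exact ⟨i (B.symm v).1, (hi _).2 ⟨_, rfl⟩, (hBB _ hv).symm.trans (B.apply_symm_apply v)⟩

lemma leftFoliation_tangent (g : G 𝕜 k p) :
    (leftFoliation hm).tangent g = h.map (dL g.T.val) := rfl

lemma mem_leftFoliation_tangent {g : G 𝕜 k p} {v : E 𝕜 k p} :
    v ∈ (leftFoliation hm).tangent g ↔ dL (sndM g.toE)⁻¹ v ∈ h := by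
  rw [leftFoliation_tangent]
  constructor
  · rintro ⟨b, hb, rfl⟩
    rw [← sndM_toE, dL_inv_dL (det_sndM_toE_ne_zero g)]
    exact hb
  · intro hv
    exact ⟨_, hv, dL_dL_inv (det_sndM_toE_ne_zero g) v⟩

lemma leftFoliation_isLeftInvariant : (leftFoliation hm).IsLeftInvariant := fun g m => by
  rw [leftFoliation_tangent, leftFoliation_tangent, ← Submodule.map_comp]
  congr 1
  refine LinearMap.ext fun v => ?_
  rw [LinearMap.comp_apply, dL_dL, G.mul_T, Units.val_mul]

lemma leftFoliation_transversal {h' : Submodule 𝕜 (E 𝕜 k p)}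
    (hm' : ∀ a ∈ h', ∀ b ∈ h', mulE a b ∈ h') (hc : IsCompl h h') :
    (leftFoliation hm).Transversal (leftFoliation hm') := fun g =>
  (Submodule.orderIsoMapComap (dLEquiv g)).isCompl hc

lemma leftFoliation_isLagrangian {α : E 𝕜 k p →ₗ[𝕜] 𝕜}
    (hl : ∀ x, x ∈ h ↔ ∀ y ∈ h, α (bracketE x y) = 0) :
    (leftFoliation hm).IsLagrangian (dLeftForm α) := fun g v => by
  rw [mem_leftFoliation_tangent, hl]
  constructor
  · intro H w hw
    rw [dLeftForm_apply, H _ ((mem_leftFoliation_tangent hm).1 hw), neg_zero]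
  · intro H y hy
    have := H (dL g.T.val y) (Submodule.mem_map_of_mem hy)
    rw [dLeftForm_apply, ← sndM_toE, dL_inv_dL (det_sndM_toE_ne_zero g), neg_eq_zero] at this
    exact this

lemma expG_inv (a : E 𝕜 k p) : (expG a)⁻¹ = expG (-a) := by
  refine inv_eq_of_mul_eq_one_right (G.toE_injective ?_)
  rw [toE_mul, toE_expG, toE_expG, add_sub_cancel_left, add_mulE, mulE_toE_one, add_assoc]
  have := expE_add_expE_neg a
  rw [add_assoc] at this
  rw [this, add_zero]

lemma hasDerivAt_mul_expG (g : G 𝕜 k p) (a : E 𝕜 k p) (t : ℝ) :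
    HasDerivAt (fun t : ℝ => (g * expG (t • a)).toE) (dL (g * expG (t • a)).T.val a) t := by
  have h1 := (((mulCLM 𝕜 k p g.toE).restrictScalars ℝ).hasFDerivAt.comp_hasDerivAt t
    (hasDerivAt_expE a t)).const_add g.toE
  have h2 : (fun t : ℝ => (g * expG (t • a)).toE) =
      fun t : ℝ => g.toE + mulE g.toE (expE (t • a)) := funext fun t => by
    rw [toE_mul, toE_expG, add_sub_cancel_left]
  rw [h2]
  refine h1.congr_deriv ?_
  change mulE g.toE (a + mulE (expE (t • a)) a) = _
  rw [G.mul_T, Units.val_mul, ← dL_dL, mulE_apply, sndM_toE]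
  congr 1
  change _ = dL (1 + sndM (expE (t • a))) a
  rw [dL_add_left, dL_one]
  rfl

lemma contDiff_mul_expG (g : G 𝕜 k p) (a : E 𝕜 k p) :
    ContDiff ℝ 1 fun t : ℝ => (g * expG (t • a)).toE := by
  have h2 : (fun t : ℝ => (g * expG (t • a)).toE) =
      fun t : ℝ => g.toE + (mulCLM 𝕜 k p g.toE).restrictScalars ℝ (expE (t • a)) :=
    funext fun t => by
      rw [toE_mul, toE_expG, add_sub_cancel_left]; rfl
  rw [h2]
  exact contDiff_const.add
    (((mulCLM 𝕜 k p g.toE).restrictScalars ℝ).contDiff.comp (contDiff_expE_smul a))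

lemma expG_zero : expG (0 : E 𝕜 k p) = 1 :=
  G.toE_injective (by rw [toE_expG, expE_zero, add_zero])

lemma leftFoliation_joined (g : G 𝕜 k p) {a : E 𝕜 k p} (ha : a ∈ h) :
    (leftFoliation hm).Joined g (g * expG a) := by
  refine ⟨fun t => g * expG (t • a), by simp [expG_zero], by simp,
    (contDiff_mul_expG g a).contDiffOn, fun t ht => ?_⟩
  rw [(hasDerivAt_mul_expG g a t).hasDerivWithinAt.derivWithin
    (uniqueDiffOn_Icc zero_lt_one t ht)]
  exact Submodule.mem_map_of_mem ha

lemma mul_mem_leaf (g : G 𝕜 k p) {l : G 𝕜 k p} (hl : l ∈ connSubgroup h) :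
    g * l ∈ (leftFoliation hm).leaf g := by
  induction hl using Subgroup.closure_induction_right with
  | one => rw [mul_one]; exact Relation.ReflTransGen.refl
  | mul_right x hx y hy ih =>
    obtain ⟨a, ha, hya⟩ := hy
    rw [isExp_iff.1 hya, ← mul_assoc]
    exact ih.tail (leftFoliation_joined hm _ ha)
  | mul_inv_cancel x hx y hy ih =>
    obtain ⟨a, ha, hya⟩ := hy
    rw [isExp_iff.1 hya, ← mul_assoc, expG_inv]
    exact ih.tail (leftFoliation_joined hm _ (h.neg_mem ha))

lemma exists_projection_ker (h : Submodule 𝕜 (E 𝕜 k p)) :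
    ∃ P : E 𝕜 k p →L[𝕜] E 𝕜 k p, (∀ x, P x = 0 ↔ x ∈ h) ∧ ∀ x, x - P x ∈ h := by
  obtain ⟨Q, hQ⟩ := h.subtype.exists_leftInverse_of_injective h.ker_subtype
  refine ⟨LinearMap.toContinuousLinearMap (LinearMap.id - h.subtype ∘ₗ Q), fun x => ?_,
    fun x => ?_⟩
  · change x - (Q x : E 𝕜 k p) = 0 ↔ _
    constructor
    · intro hx
      rw [sub_eq_zero.1 hx]
      exact (Q x).2
    · intro hx
      have := LinearMap.congr_fun hQ ⟨x, hx⟩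
      exact sub_eq_zero.2 (congrArg Subtype.val this).symm
  · change x - (x - (Q x : E 𝕜 k p)) ∈ h
    rw [sub_sub_cancel]
    exact (Q x).2

include hm in
/-- A solution of `b' = b a` with `a(t) ∈ 𝔥` that starts in `1 + 𝔥` stays there. -/
lemma sub_one_mem_of_hasDerivWithinAt {b b' a : ℝ → E 𝕜 k p}
    (hb : ∀ t ∈ Set.Icc (0 : ℝ) 1, HasDerivWithinAt b (b' t) (Set.Icc 0 1) t)
    (hab : ∀ t ∈ Set.Icc (0 : ℝ) 1, b' t = mulE (b t) (a t))
    (ha : ∀ t ∈ Set.Icc (0 : ℝ) 1, a t ∈ h) (hac : ContinuousOn a (Set.Icc 0 1))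
    (h0 : b 0 = (1 : G 𝕜 k p).toE) :
    ∀ t ∈ Set.Icc (0 : ℝ) 1, b t - (1 : G 𝕜 k p).toE ∈ h := by
  obtain ⟨P, hP, hPh⟩ := exists_projection_ker h
  obtain ⟨C, hC⟩ := isCompact_Icc.exists_bound_of_continuousOn hac
  -- `y` measures the distance from `1 + 𝔥`. Modulo `𝔥`, replacing `b` by `y` in `b a` changes
  -- nothing, so `y' = P (y a)` is linear in `y` and Grönwall's inequality gives `y = 0`.
  let y : ℝ → E 𝕜 k p := fun t => P (b t - (1 : G 𝕜 k p).toE)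
  have hy : ∀ t ∈ Set.Icc (0 : ℝ) 1, HasDerivWithinAt y (P (b' t)) (Set.Icc 0 1) t :=
    fun t ht => (P.restrictScalars ℝ).hasFDerivAt.comp_hasDerivWithinAt t
      ((hb t ht).sub_const _)
  have hPb : ∀ t ∈ Set.Icc (0 : ℝ) 1, P (b' t) = P (mulE (y t) (a t)) := fun t ht => by
    rw [hab t ht, ← sub_eq_zero, ← map_sub, hP]
    have h1 : mulE (b t) (a t) - mulE (y t) (a t) =
        a t + mulE ((b t - (1 : G 𝕜 k p).toE) - y t) (a t) := by
      rw [sub_mulE, sub_mulE, mulE_toE_one]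
      abel
    rw [h1]
    exact h.add_mem (ha t ht) (hm _ (hPh _) _ (ha t ht))
  have hzero := eq_zero_of_abs_deriv_le_mul_abs_self_of_eq_zero_right (f := y)
    (f' := fun t => P (b' t)) (K := ‖P‖ * (‖mulCLM 𝕜 k p‖ * C)) (a := 0) (b := 1)
    (fun t ht => (hy t ht).continuousWithinAt)
    (fun t ht => (hy t ⟨ht.1, ht.2.le⟩).mono_of_mem_nhdsWithin (Icc_mem_nhdsGE_of_mem ht))
    (by simp [y, h0]) fun t ht => by
      have ht' : t ∈ Set.Icc (0 : ℝ) 1 := ⟨ht.1, ht.2.le⟩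
      rw [hPb t ht']
      calc ‖P (mulE (y t) (a t))‖ ≤ ‖P‖ * ‖mulCLM 𝕜 k p (y t) (a t)‖ := P.le_opNorm _
        _ ≤ ‖P‖ * (‖mulCLM 𝕜 k p‖ * ‖y t‖ * C) := by
          gcongr
          exact ((mulCLM 𝕜 k p).le_opNorm₂ _ _).trans (by gcongr; exact hC t ht')
        _ = ‖P‖ * (‖mulCLM 𝕜 k p‖ * C) * ‖y t‖ := by ring
  exact fun t ht => (hP _).1 (hzero t ht)

include hm in
-- The path moved to start at `1` stays in `translateGroup` by the differential equation. Since
-- `connSubgroup h` is open and closed there, connectedness of `[0, 1]` keeps the path inside it.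
lemma inv_mul_mem_of_joined {g m : G 𝕜 k p} (hgm : (leftFoliation hm).Joined g m) :
    g⁻¹ * m ∈ connSubgroup h := by
  obtain ⟨γ, rfl, rfl, hγ, hγt⟩ := hgm
  let γ' : ℝ → E 𝕜 k p := derivWithin (fun t => (γ t).toE) (Set.Icc 0 1)
  have hγ'c : ContinuousOn γ' (Set.Icc 0 1) :=
    hγ.continuousOn_derivWithin (uniqueDiffOn_Icc zero_lt_one) le_rfl
  have hγc : ContinuousOn γ (Set.Icc 0 1) := by
    rw [G.isOpenEmbedding_toE.toIsEmbedding.isInducing.continuousOn_iff]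
    exact hγ.continuousOn
  let β : ℝ → G 𝕜 k p := fun t => (γ 0)⁻¹ * γ t
  have hβ : ∀ t, (β t).toE = (γ 0)⁻¹.toE + mulE (γ 0)⁻¹.toE ((γ t).toE - (1 : G 𝕜 k p).toE) :=
    fun t => toE_mul _ _
  let a : ℝ → E 𝕜 k p := fun t => dL (sndM (γ t).toE)⁻¹ (γ' t)
  have hac : ContinuousOn a (Set.Icc 0 1) := fun t ht => by
    have h1 : ContinuousWithinAt (fun t => invE (γ t).toE) (Set.Icc 0 1) t :=
      ContinuousAt.comp_continuousWithinAt (f := fun t => (γ t).toE)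
        (contDiffAt_invE (γ t)).continuousAt (hγ.continuousOn t ht)
    exact ((mulCLM 𝕜 k p).continuous.continuousAt.comp_continuousWithinAt h1).clm_apply (hγ'c t ht)
  have hΓ : ∀ t ∈ Set.Icc (0 : ℝ) 1, (β t).toE - (1 : G 𝕜 k p).toE ∈ h := by
    refine sub_one_mem_of_hasDerivWithinAt hm (b := fun t => (β t).toE)
      (b' := fun t => mulE (γ 0)⁻¹.toE (γ' t)) (a := a) (fun t ht => ?_) (fun t ht => ?_)
      (fun t ht => (mem_leftFoliation_tangent hm).1 (hγt t ht)) hac (by simp [β])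
    · have h1 : HasDerivWithinAt (fun t => (γ t).toE) (γ' t) (Set.Icc 0 1) t :=
        (hγ.differentiableOn one_ne_zero t ht).hasDerivWithinAt
      have h2 := (((mulCLM 𝕜 k p (γ 0)⁻¹.toE).restrictScalars ℝ).hasFDerivAt.comp_hasDerivWithinAt
        t (h1.sub_const (1 : G 𝕜 k p).toE)).const_add (γ 0)⁻¹.toE
      simp only [hβ]
      exact h2
    · have h1 : γ' t = dL (sndM (γ t).toE) (a t) := (dL_dL_inv (det_sndM_toE_ne_zero _) _).symm
      rw [h1, mulE_apply, mulE_apply, dL_dL]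
      rfl
  let S : Set (Set.Icc (0 : ℝ) 1) := {t | β t ∈ connSubgroup h}
  have hβc : Continuous fun t : Set.Icc (0 : ℝ) 1 => β t :=
    continuous_const.mul (continuousOn_iff_continuous_domRestrict.1 hγc)
  have hS : IsClopen S := by
    refine ⟨(isClosed_connSubgroup hm).preimage hβc, isOpen_iff_mem_nhds.2 fun t ht => ?_⟩
    filter_upwards [hβc.continuousAt.eventually
      (eventually_inv_mul_mem_connSubgroup hm (β t))] with s hs
    have h1 := hs ((translateGroup hm).mul_mem ((translateGroup hm).inv_mem (hΓ t t.2))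
      (hΓ s s.2))
    have h2 := (connSubgroup h).mul_mem ht h1
    rwa [mul_inv_cancel_left] at h2
  have hSu : S = Set.univ := by
    refine hS.eq_univ ⟨(⟨0, by simp⟩ : Set.Icc (0 : ℝ) 1), ?_⟩
    change (γ 0)⁻¹ * γ 0 ∈ connSubgroup h
    rw [inv_mul_cancel]
    exact one_mem _
  have h1 : (⟨1, by simp⟩ : Set.Icc (0 : ℝ) 1) ∈ S := hSu ▸ Set.mem_univ _
  exact h1

lemma leftFoliation_leaf (g : G 𝕜 k p) :
    (leftFoliation hm).leaf g = {m | g⁻¹ * m ∈ connSubgroup h} := by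
  ext m
  constructor
  · intro hgm
    induction hgm with
    | refl =>
      change g⁻¹ * g ∈ connSubgroup h
      rw [inv_mul_cancel]
      exact one_mem _
    | tail _ hbc ih =>
      have := (connSubgroup h).mul_mem ih (inv_mul_mem_of_joined hm hbc)
      rwa [mul_assoc, mul_inv_cancel_left] at this
  · intro hgm
    have := mul_mem_leaf hm g hgm
    rwa [mul_inv_cancel_left] at this

lemma isClosed_leftFoliation_leaf (g : G 𝕜 k p) : IsClosed ((leftFoliation hm).leaf g) := by
  rw [leftFoliation_leaf]
  exact (isClosed_connSubgroup hm).preimage (continuous_const_mul g⁻¹)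

/-- In the left trivialization `∇⁺_X Y` is a derivative plus a `symProd` term. The latter stays in
`h` by `symProd_mem`; the former is computed along a curve in the leaf, where the trivialized `Y`
takes values in `h`. -/
lemma leftFoliation_hasAffineLeaf {α : E 𝕜 k p →ₗ[𝕜] 𝕜}
    (hα : IsLeftInvariantSymplectic (dLeftForm α))
    (hl : ∀ x, x ∈ h ↔ ∀ y ∈ h, α (bracketE x y) = 0) (g : G 𝕜 k p) :
    (leftFoliation hm).HasAffineLeaf (dLeftForm α) g := by
  intro m hmg X Y hX hY hXY
  have hXYm := hXY.self_of_nhds hmg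
  have hXm := (mem_leftFoliation_tangent hm).1 hXYm.1
  have hYm := (mem_leftFoliation_tangent hm).1 hXYm.2
  set a := dL (sndM m.toE)⁻¹ (X m.toE) with ha
  have hXa : X m.toE = dL (sndM m.toE) a := (dL_dL_inv (det_sndM_toE_ne_zero m) _).symm
  refine Submodule.mem_map_of_mem (h.add_mem ?_
    (symProd_mem hα (fun x hx y hy => h.sub_mem (hm x hx y hy) (hm y hy x hx)) hl hXm hYm))
  let ψ : E 𝕜 k p → E 𝕜 k p := fun e => dL (sndM e)⁻¹ (Y e)
  have hψ : DifferentiableAt 𝕜 ψ m.toE := (contDiffAt_dL_inv m hY).differentiableAt (by simp)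
  have hcurve := hasDerivAt_mul_expG m a 0
  -- The curve `t ↦ m exp(t a)` has velocity `X` at `m` and lies in the leaf. Tangency is assumed
  -- only at leaf points, so the derivative must be taken along such a curve.
  have hm0 : m * expG ((0 : ℝ) • a) = m := by rw [zero_smul, expG_zero, mul_one]
  have hder : HasDerivAt (fun t : ℝ => ψ (m * expG (t • a)).toE)
      (fderiv 𝕜 ψ m.toE (X m.toE)) 0 := by
    have h1 : HasFDerivAt ψ ((fderiv 𝕜 ψ m.toE).restrictScalars ℝ)
        (m * expG ((0 : ℝ) • a)).toE := by
      rw [hm0]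
      exact hψ.hasFDerivAt.restrictScalars ℝ
    refine (h1.comp_hasDerivAt (0 : ℝ) hcurve).congr_deriv ?_
    rw [hm0, hXa]
    rfl
  have hc : Filter.Tendsto (fun t : ℝ => m * expG (t • a)) (𝓝 0) (𝓝 m) := by
    rw [G.isOpenEmbedding_toE.toIsEmbedding.isInducing.tendsto_nhds_iff]
    have := hcurve.continuousAt.tendsto
    rwa [hm0] at this
  have hev : ∀ᶠ t : ℝ in 𝓝 0, ψ (m * expG (t • a)).toE ∈ h := by
    filter_upwards [hc.eventually hXY] with t ht
    refine (mem_leftFoliation_tangent hm).1 (ht ?_).2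
    rw [leftFoliation_leaf] at hmg ⊢
    change g⁻¹ * (m * expG (t • a)) ∈ connSubgroup h
    rw [← mul_assoc]
    refine (connSubgroup h).mul_mem hmg (expG_mem_connSubgroup ?_)
    rw [RCLike.real_smul_eq_coe_smul (K := 𝕜)]
    exact h.smul_mem _ hXm
  refine (Submodule.closed_of_finiteDimensional h).mem_of_tendsto hder.tendsto_slope_zero ?_
  filter_upwards [nhdsWithin_le_nhds hev] with t ht
  rw [RCLike.real_smul_eq_coe_smul (K := 𝕜), zero_add]
  refine h.smul_mem _ (h.sub_mem ht ?_)
  rw [hm0]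
  exact hYm

end Foliation

/-! ### Transport by the adjoint action -/

/-- `Ad g` is conjugation in `gl(𝕜ⁿ⁺ᵖ)`, so it respects the associative product; this keeps the
conjugates of `L` and `L'` product-closed. -/
lemma Ad_mulE (g : G 𝕜 k p) (a b : E 𝕜 k p) : Ad g (mulE a b) = mulE (Ad g a) (Ad g b) := by
  have h : ∀ {m : Type} (A : Matrix (Fin k × Fin p) m 𝕜), g.T⁻¹.val * (g.T.val * A) = A :=
    fun A => by rw [← Matrix.mul_assoc, Units.inv_mul, Matrix.one_mul]
  refine ext_fstM_sndM ?_ ?_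
  · simp only [fstM_Ad, fstM_mulE, sndM_mulE, sndM_Ad, Matrix.mul_sub, Matrix.mul_assoc, h]
  · simp only [sndM_mulE, sndM_Ad, Matrix.mul_assoc, h]

lemma Ad_bracketE (g : G 𝕜 k p) (a b : E 𝕜 k p) :
    Ad g (bracketE a b) = bracketE (Ad g a) (Ad g b) := by
  rw [bracketE, map_sub, Ad_mulE, Ad_mulE, bracketE]

lemma Ad_one (a : E 𝕜 k p) : Ad 1 a = a := ext_fstM_sndM (by simp) (by simp)

lemma Ad_mul (g m : G 𝕜 k p) (a : E 𝕜 k p) : Ad (g * m) a = Ad g (Ad m a) := by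
  have h : ∀ {n : Type} (A : Matrix (Fin k × Fin p) n 𝕜), g.T⁻¹.val * (g.T.val * A) = A :=
    fun A => by rw [← Matrix.mul_assoc, Units.inv_mul, Matrix.one_mul]
  refine ext_fstM_sndM ?_ ?_
  · simp only [fstM_Ad, sndM_Ad, G.mul_T, G.mul_X, mul_inv_rev, Units.val_mul, Matrix.mul_sub,
      Matrix.mul_add, Matrix.mul_assoc, h]
    abel
  · simp only [sndM_Ad, G.mul_T, mul_inv_rev, Units.val_mul, Matrix.mul_assoc]

/-- The adjoint action as a linear equivalence. -/
def AdEquiv (g : G 𝕜 k p) : E 𝕜 k p ≃ₗ[𝕜] E 𝕜 k p :=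
  LinearEquiv.ofLinearMap (Ad g) (Ad g⁻¹)
    (LinearMap.ext fun a => by rw [LinearMap.comp_apply, ← Ad_mul, mul_inv_cancel, Ad_one]; rfl)
    (LinearMap.ext fun a => by rw [LinearMap.comp_apply, ← Ad_mul, inv_mul_cancel, Ad_one]; rfl)

lemma grpEmb_one : grpEmb (1 : G 𝕜 k p) = 1 := by
  rw [grpEmb_eq, sub_self]
  exact (congrArg (1 + ·) (map_zero algEmbLin)).trans (add_zero 1)

lemma grpEmb_mul (g m : G 𝕜 k p) : grpEmb (g * m) = grpEmb g * grpEmb m := by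
  simp [grpEmb, Matrix.fromBlocks_multiply, add_comm]

lemma algEmb_Ad (g : G 𝕜 k p) (a : E 𝕜 k p) :
    algEmb (Ad g a) = grpEmb g * algEmb a * grpEmb g⁻¹ := by
  simp [grpEmb, algEmb, Matrix.fromBlocks_multiply, Matrix.mul_assoc, sub_eq_neg_add]

lemma IsExp.conj {a : E 𝕜 k p} {g : G 𝕜 k p} (h : IsExp a g) (c : G 𝕜 k p) :
    IsExp (Ad c a) (c * g * c⁻¹) := by
  have hc : grpEmb c * grpEmb c⁻¹ = 1 := by rw [← grpEmb_mul, mul_inv_cancel, grpEmb_one]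
  have hinv : grpEmb c⁻¹ = (grpEmb c)⁻¹ := (Matrix.inv_eq_right_inv hc).symm
  have hu : IsUnit (grpEmb c) := IsUnit.of_mul_eq_one _ hc
  rw [IsExp, grpEmb_mul, grpEmb_mul, h, algEmb_Ad, hinv, Matrix.exp_conj _ _ hu]

lemma connSubgroup_map_Ad (h : Submodule 𝕜 (E 𝕜 k p)) (c : G 𝕜 k p) :
    connSubgroup (h.map (Ad c)) = (connSubgroup h).map (MulAut.conj c).toMonoidHom := by
  rw [connSubgroup, connSubgroup, MonoidHom.map_closure]
  congr 1
  ext g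
  constructor
  · rintro ⟨_, ⟨a, ha, rfl⟩, hg⟩
    refine ⟨expG a, ⟨a, ha, isExp_expG a⟩, ?_⟩
    rw [isExp_iff] at hg
    rw [hg]
    exact isExp_iff.1 ((isExp_expG a).conj c)
  · rintro ⟨g, ⟨a, ha, hg⟩, rfl⟩
    exact ⟨Ad c a, Submodule.mem_map_of_mem ha, hg.conj c⟩

lemma mulE_mem_map_Ad {h : Submodule 𝕜 (E 𝕜 k p)} (hm : ∀ a ∈ h, ∀ b ∈ h, mulE a b ∈ h)
    (c : G 𝕜 k p) : ∀ a ∈ h.map (Ad c), ∀ b ∈ h.map (Ad c), mulE a b ∈ h.map (Ad c) := by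
  rintro _ ⟨a, ha, rfl⟩ _ ⟨b, hb, rfl⟩
  exact ⟨mulE a b, hm a ha b hb, Ad_mulE c a b⟩

lemma isotropic_map_Ad {h : Submodule 𝕜 (E 𝕜 k p)} {α β : E 𝕜 k p →ₗ[𝕜] 𝕜} {g : G 𝕜 k p}
    (hg : ∀ a, β (Ad g a) = α a) (hb : ∀ x ∈ h, ∀ y ∈ h, β (bracketE x y) = 0) :
    ∀ x ∈ h.map (Ad g⁻¹), ∀ y ∈ h.map (Ad g⁻¹), α (bracketE x y) = 0 := by
  rintro _ ⟨a, ha, rfl⟩ _ ⟨b, hb', rfl⟩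
  rw [← hg, ← Ad_bracketE, ← Ad_mul, mul_inv_cancel, Ad_one]
  exact hb a ha b hb'

lemma leftFoliation_map_Ad_leaf {h : Submodule 𝕜 (E 𝕜 k p)} (hm : ∀ a ∈ h, ∀ b ∈ h, mulE a b ∈ h)
    (c g : G 𝕜 k p) : (leftFoliation (mulE_mem_map_Ad hm c)).leaf g =
      {m | ∃ l ∈ connSubgroup h, m = g * (c * l * c⁻¹)} := by
  rw [leftFoliation_leaf]
  ext m
  rw [Set.mem_ofPred_eq, connSubgroup_map_Ad, Subgroup.mem_map]
  refine exists_congr fun l => and_congr_right fun _ => ?_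
  change c * l * c⁻¹ = g⁻¹ * m ↔ _
  rw [eq_inv_mul_iff_mul_eq, eq_comm]

lemma α₀_bracketE_of_mem_L : ∀ x ∈ L 𝕜 k p, ∀ y ∈ L 𝕜 k p, α₀ 𝕜 k p (bracketE x y) = 0 :=
  fun x hx y hy => by
    rw [bracketE, map_sub, α₀_mulE_eq_zero_of_mem_L hx hy, α₀_mulE_eq_zero_of_mem_L hy hx,
      sub_self]

lemma α₀_bracketE_of_mem_L' : ∀ x ∈ L' 𝕜 k p, ∀ y ∈ L' 𝕜 k p, α₀ 𝕜 k p (bracketE x y) = 0 :=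
  fun _ hx _ hy => α₀_eq_zero_of_mem_L' ((L' 𝕜 k p).sub_mem (mulE_mem_L' hx hy) (mulE_mem_L' hy hx))

end

end Gnp

open Gnp
theorem theorem3p2 {𝕜 : Type*} [RCLike 𝕜] (k p : ℕ) (hk : 1 ≤ k) (hp : 1 ≤ p) :
    IsLeftInvariantSymplectic (dLeftForm (α₀ 𝕜 k p)) ∧
    lieAlgebraOf (connSubgroup (L 𝕜 k p)) = (L 𝕜 k p : Set (E 𝕜 k p)) ∧
    lieAlgebraOf (connSubgroup (L' 𝕜 k p)) = (L' 𝕜 k p : Set (E 𝕜 k p)) ∧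
    ∀ α : E 𝕜 k p →ₗ[𝕜] 𝕜, IsLeftInvariantSymplectic (dLeftForm α) →
      IsAffineStructure (dLeftForm α) ∧
      ∃ c : G 𝕜 k p, (α = α₀ 𝕜 k p → c = 1) ∧
      ∃ F F' : Foliation 𝕜 k p,
        F.IsLeftInvariant ∧ F'.IsLeftInvariant ∧
        F.IsLagrangian (dLeftForm α) ∧ F'.IsLagrangian (dLeftForm α) ∧
        F.Transversal F' ∧
        ∀ g : G 𝕜 k p,
          F.leaf g = {h | ∃ l ∈ connSubgroup (L 𝕜 k p), h = g * (c * l * c⁻¹)} ∧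
          F'.leaf g = {h | ∃ l ∈ connSubgroup (L' 𝕜 k p), h = g * (c * l * c⁻¹)} ∧
          IsClosed (F.leaf g) ∧ IsClosed (F'.leaf g) ∧
          F.HasAffineLeaf (dLeftForm α) g ∧ F'.HasAffineLeaf (dLeftForm α) g := by
  have hL : ∀ a ∈ L 𝕜 k p, ∀ b ∈ L 𝕜 k p, mulE a b ∈ L 𝕜 k p :=
    fun _ ha _ hb => mulE_mem_L ha hb
  have hL' : ∀ a ∈ L' 𝕜 k p, ∀ b ∈ L' 𝕜 k p, mulE a b ∈ L' 𝕜 k p :=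
    fun _ ha _ hb => mulE_mem_L' ha hb
  refine ⟨isLeftInvariantSymplectic_α₀, lieAlgebraOf_connSubgroup hL,
    lieAlgebraOf_connSubgroup hL', fun α hα => ⟨isAffineStructure_dLeftForm hα, ?_⟩⟩
  -- The normal form does not return `g = 1` for `α = α₀`, since its `g` is only some element of
  -- `G`; this case is therefore treated apart.
  obtain ⟨g, hg1, hg⟩ : ∃ g : G 𝕜 k p, (α = α₀ 𝕜 k p → g = 1) ∧
      ∀ a, α₀ 𝕜 k p (Ad g a) = α a := by
    by_cases h : α = α₀ 𝕜 k p
    · exact ⟨1, fun _ => rfl, fun a => by rw [Ad_one, h]⟩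
    · obtain ⟨g, hg⟩ := exists_α₀_Ad_eq hk hp hα
      exact ⟨g, fun h' => absurd h' h, hg⟩
  have hc : IsCompl ((L 𝕜 k p).map (Ad g⁻¹)) ((L' 𝕜 k p).map (Ad g⁻¹)) :=
    (Submodule.orderIsoMapComap (AdEquiv g⁻¹)).isCompl isCompl_L_L'
  have h1 := isotropic_map_Ad hg α₀_bracketE_of_mem_L
  have h2 := isotropic_map_Ad hg α₀_bracketE_of_mem_L'
  have hl := mem_iff_of_isCompl_of_isotropic hα hc h1 h2
  have hl' := mem_iff_of_isCompl_of_isotropic hα hc.symm h2 h1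
  have hm := mulE_mem_map_Ad hL g⁻¹
  have hm' := mulE_mem_map_Ad hL' g⁻¹
  exact ⟨g⁻¹, fun h => by rw [hg1 h, inv_one], leftFoliation hm, leftFoliation hm',
    leftFoliation_isLeftInvariant hm, leftFoliation_isLeftInvariant hm',
    leftFoliation_isLagrangian hm hl, leftFoliation_isLagrangian hm' hl',
    leftFoliation_transversal hm hm' hc, fun m =>
    ⟨leftFoliation_map_Ad_leaf hL g⁻¹ m, leftFoliation_map_Ad_leaf hL' g⁻¹ m,
      isClosed_leftFoliation_leaf hm m, isClosed_leftFoliation_leaf hm' m,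
      leftFoliation_hasAffineLeaf hm hα hl m, leftFoliation_hasAffineLeaf hm' hα hl' m⟩⟩
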